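/- Let $k\ge 3$. For elements $s,t$ of a monoid write $\mathrm{prod}(s,t;n)=ststs\cdots$ ($n$ alternating factors, starting with $s$). Let $$A_k=\langle a,b \mid \mathrm{prod}(a,b;k)=\mathrm{prod}(b,a;k)\rangle$$ be the Artin group of dihedral type, with the word metric $d$ of the Artin generators $\{a,b,a^{-1},b^{-1}\}$, so that $d(g,h)$ is the length of a shortest word in these generators representing $g^{-1}h$. Put $\Delta=\mathrm{prod}(a,b;k)$ and $$M^+=\{a,b,ab,ba,\dots,\mathrm{prod}(a,b;k-1),\mathrm{prod}(b,a;k-1)\}\subset A_k .$$ Let $\mathcal M$ be the horofunction compactification of $(A_k,d)$ with basepoint the identity $e$, that is, the closure of the set of functions $\phi_z\colon x\mapsto d(x,z)-d(e,z)$, $z\in A_k$, in the space $C(A_k)$ of continuous real-valued functions on $A_k$ with the topology of uniform convergence on compact sets. Let $Z$ be the set of finite (possibly empty) or infinite words in the letters $a,b$ in which no product of consecutive letters equals $\Delta$ in $A_k$, with the topology of letterwise convergence (a sequence $z^n$ converges to $z$ iff, for each position $j$, for all large $n$ the word $z^n$ has a $j$-th letter iff $z$ does, and then the two letters agree). Each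 $z\in Z$ is in exactly one way a concatenation of finitely or infinitely many finite substrings such that the product of the letters of every substring is in $M^+$ and the product of the letters of any two consecutive substrings together is not in $M^+$. Let $m_i(z)\in\{0,1,2,\dots,\infty\}$ be the number of these substrings that have length $i$. Let $\Omega'$ be the set of $(p,z)=((p_0,\dots,p_{k-1}),z)\in(\mathbb Z\cup\{-\infty,+\infty\})^k\times Z$ such that, for every $i\in\{1,\dots,k-1\}$ for which $p_i,p_{i-1}$ are not both $-\infty$ and not both $+\infty$, - $p_i-p_{i-1}\ge m_{k-i}(z)$, and - if $z$ is finite, then $p_i-p_{i-1}=m_{k-i}(z)$. Give $\mathbb Z\cup\{-\infty,+\infty\}$ its order topology, the product its product topology and $\Omega'$ the subspace topology. Let $\Omega$ be the quotient space of $\Omega'$ in which all points of $\Omega'$ with $p=(+\infty,\dots,+\infty)$ are identified with each other, and all points with $p=(-\infty,\dots,-\infty)$ are identified with each other. **Theorem.** For every $k\ge3$, the spaces $\Omega$ and $\mathcal M$ are homeomorphic. -/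

import Mathlib

open scoped ENNReal

noncomputable section

/-! ### The horofunction compactification of a metric space -/

section Horofunction

variable {X : Type*} [MetricSpace X]

/-- The function `φ_z : x ↦ d(x, z) - d(b, z)`. -/
def horoEmbedding (b z : X) : C(X, ℝ) where
  toFun x := dist x z - dist b z
  continuous_toFun := by fun_prop

/-- The closure of `{φ_z | z ∈ X}` in `C(X, ℝ)`; Mathlib's topology on `C(X, ℝ)` is that of
uniform convergence on compact sets. -/
def horofunctionCompactification (b : X) : Set C(X, ℝ) :=
  closure (Set.range (horoEmbedding b))

end Horofunction

/-! ### The word metric on a group -/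

section WordMetric

variable {G : Type*} [Group G]

/-- The least length of a word in the elements of `S` that represents `g`. -/
def wordLength (S : Set G) (g : G) : ℕ :=
  sInf {n : ℕ | ∃ l : List G, (∀ x ∈ l, x ∈ S) ∧ l.length = n ∧ l.prod = g}

lemma wordLength_le (S : Set G) (l : List G) (hl : ∀ x ∈ l, x ∈ S) :
    wordLength S l.prod ≤ l.length :=
  Nat.sInf_le ⟨l, hl, rfl, rfl⟩

lemma exists_word_of_generates {S : Set G} (hinv : ∀ x ∈ S, x⁻¹ ∈ S)
    (hgen : Subgroup.closure S = ⊤) (g : G) :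
    ∃ l : List G, (∀ x ∈ l, x ∈ S) ∧ l.length = wordLength S g ∧ l.prod = g := by
  have hg : g ∈ (Subgroup.closure S).toSubmonoid := hgen ▸ Subgroup.mem_top g
  rw [Subgroup.closure_toSubmonoid] at hg
  obtain ⟨l, hl, hp⟩ := Submonoid.exists_list_of_mem_closure hg
  have hne : {n : ℕ | ∃ l : List G, (∀ x ∈ l, x ∈ S) ∧ l.length = n ∧ l.prod = g}.Nonempty :=
    ⟨l.length, l, fun x hx => (hl x hx).elim id fun h => by simpa using hinv _ h, rfl, hp⟩
  exact Nat.sInf_mem hne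

/-- The word metric `d(g, h) = |g⁻¹ h|` of a symmetric generating set `S`. -/
abbrev wordMetric (S : Set G) (hinv : ∀ x ∈ S, x⁻¹ ∈ S) (hgen : Subgroup.closure S = ⊤) :
    MetricSpace G where
  dist g h := (wordLength S (g⁻¹ * h) : ℝ)
  dist_self g := by
    have := wordLength_le S ([] : List G) (by simp)
    simpa using this
  dist_comm g h := by
    have key : ∀ u : G, wordLength S u⁻¹ ≤ wordLength S u := fun u => by
      obtain ⟨l, hl, hlen, hp⟩ := exists_word_of_generates hinv hgen u
      have := wordLength_le S (l.map (·⁻¹)).reverse (by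
        intro x hx
        simp only [List.mem_reverse, List.mem_map] at hx
        obtain ⟨y, hy, rfl⟩ := hx
        exact hinv y (hl y hy))
      rw [← List.prod_inv_reverse, hp] at this
      simpa [hlen] using this
    have h1 := key (g⁻¹ * h)
    have h2 := key (h⁻¹ * g)
    simp only [mul_inv_rev, inv_inv] at h1 h2
    exact_mod_cast le_antisymm h2 h1
  dist_triangle g h u := by
    obtain ⟨l, hl, hlen, hp⟩ := exists_word_of_generates hinv hgen (g⁻¹ * h)
    obtain ⟨l', hl', hlen', hp'⟩ := exists_word_of_generates hinv hgen (h⁻¹ * u)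
    have := wordLength_le S (l ++ l') (by
      intro x hx
      exact (List.mem_append.1 hx).elim (hl x) (hl' x))
    rw [List.prod_append, hp, hp', List.length_append, hlen, hlen'] at this
    have e : g⁻¹ * h * (h⁻¹ * u) = g⁻¹ * u := by group
    rw [e] at this
    exact_mod_cast this
  eq_of_dist_eq_zero := by
    intro g h h0
    obtain ⟨l, hl, hlen, hp⟩ := exists_word_of_generates hinv hgen (g⁻¹ * h)
    have h1 : wordLength S (g⁻¹ * h) = 0 := by exact_mod_cast h0
    rw [h1, List.length_eq_zero_iff] at hlen
    rw [hlen, List.prod_nil] at hp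
    exact (inv_mul_eq_one.1 hp.symm)

end WordMetric

/-! ### Artin groups of dihedral type -/

/-- The alternating product `s t s t ⋯` with `n` factors. -/
def alternatingProd {M : Type*} [Monoid M] (s t : M) : ℕ → M
  | 0 => 1
  | n + 1 => s * alternatingProd t s n

/-- The group `A_k = ⟨a, b ∣ prod(a, b; k) = prod(b, a; k)⟩`; the letter `a` is `false` and the
letter `b` is `true`. -/
def DihedralArtin (k : ℕ) : Type :=
  PresentedGroup
    ({alternatingProd (FreeGroup.of false) (FreeGroup.of true) k *
      (alternatingProd (FreeGroup.of true) (FreeGroup.of false) k)⁻¹} : Set (FreeGroup Bool))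

namespace DihedralArtin

instance (k : ℕ) : Group (DihedralArtin k) :=
  inferInstanceAs (Group (PresentedGroup _))

/-- The generator `a` (for `false`) or `b` (for `true`). -/
def gen (k : ℕ) (x : Bool) : DihedralArtin k := PresentedGroup.of x

/-- The set `{a, b, a⁻¹, b⁻¹}` of Artin generators. -/
def artinGenerators (k : ℕ) : Set (DihedralArtin k) :=
  {gen k false, gen k true, (gen k false)⁻¹, (gen k true)⁻¹}

lemma inv_mem_artinGenerators (k : ℕ) (x : DihedralArtin k) (hx : x ∈ artinGenerators k) :
    x⁻¹ ∈ artinGenerators k := by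
  simp only [artinGenerators, Set.mem_insert_iff, Set.mem_singleton_iff] at hx ⊢
  rcases hx with rfl | rfl | rfl | rfl <;> simp

lemma closure_artinGenerators (k : ℕ) : Subgroup.closure (artinGenerators k) = ⊤ := by
  have h : Subgroup.closure (Set.range (gen k)) = ⊤ := PresentedGroup.closure_range_of _
  rw [eq_top_iff, ← h]
  apply Subgroup.closure_mono
  rintro _ ⟨x, rfl⟩
  cases x <;> simp [artinGenerators]

/-- The Artin-generator word metric. -/
instance (k : ℕ) : MetricSpace (DihedralArtin k) :=
  wordMetric (artinGenerators k) (inv_mem_artinGenerators k) (closure_artinGenerators k)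

/-- The Garside element `Δ = prod(a, b; k)`. -/
def garside (k : ℕ) : DihedralArtin k := alternatingProd (gen k false) (gen k true) k

/-- The set `M⁺ = {a, b, ab, ba, …, prod(a, b; k - 1), prod(b, a; k - 1)}`. -/
def Mplus (k : ℕ) : Set (DihedralArtin k) :=
  {g | ∃ j, 1 ≤ j ∧ j < k ∧ ∃ x : Bool, g = alternatingProd (gen k x) (gen k (!x)) j}

/-- The element of `A_k` represented by a finite word of positive generators. -/
def wordProd (k : ℕ) (u : List Bool) : DihedralArtin k := (u.map (gen k)).prod

/-- The finite word `u` occurs in the possibly infinite word `z` at position `n`. -/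
def OccursAt (z : Stream'.Seq Bool) (n : ℕ) (u : List Bool) : Prop :=
  ∀ j < u.length, z.get? (n + j) = u[j]?

/-- The set `Z` of possibly infinite (and possibly empty) words of positive generators in which
no product of consecutive letters equals `Δ`. -/
def DeltaFreeWord (k : ℕ) : Type :=
  {z : Stream'.Seq Bool // ∀ (n : ℕ) (u : List Bool), OccursAt z n u → wordProd k u ≠ garside k}

/-- The topology of letterwise convergence: the coarsest one for which each map sending a word to
its `n`-th letter (or to `none` if there is no such letter) is continuous into the discrete space
of possible values. -/
instance (k : ℕ) : TopologicalSpace (DeltaFreeWord k) :=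
  ⨅ n : ℕ, TopologicalSpace.induced (fun z => z.1.get? n) ⊥

/-- The position in the concatenation of the words of `D` at which the `n`-th word starts. -/
def startPos (D : Stream'.Seq (List Bool)) (n : ℕ) : ℕ :=
  ∑ i ∈ Finset.range n, ((D.get? i).elim 0 List.length)

/-- `D` is a (finite or infinite) sequence of finite words whose concatenation is `z`, such that
the product of each word is in `M⁺` and the product of each two consecutive ones is not. For a
word `z` of `Z` there is exactly one such `D`. -/
structure IsDecomposition (k : ℕ) (z : Stream'.Seq Bool) (D : Stream'.Seq (List Bool)) :
    Prop where
  occursAt : ∀ n u, D.get? n = some u → OccursAt z (startPos D n) u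
  exhausts : ∀ n, D.get? n = none → z.get? (startPos D n) = none
  mem : ∀ n u, D.get? n = some u → wordProd k u ∈ Mplus k
  not_mem : ∀ n u v, D.get? n = some u → D.get? (n + 1) = some v →
    wordProd k u * wordProd k v ∉ Mplus k

/-- `m_i(z)`: the number of substrings of length `i` in the decomposition of `z`. -/
def substringCount (k : ℕ) (z : DeltaFreeWord k) (i : ℕ) : ℕ∞ :=
  {n : ℕ | ∃ D, IsDecomposition k z.1 D ∧ ∃ u, D.get? n = some u ∧ u.length = i}.encard

end DihedralArtin

/-! ### The space `Ω` -/

/-- The set `ℤ ∪ {-∞, +∞}`, with the order topology, realised as a subspace of `[-∞, +∞]`. -/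
def ExtInt : Set EReal := {x | x = ⊥ ∨ x = ⊤ ∨ ∃ n : ℤ, x = ((n : ℝ) : EReal)}

open DihedralArtin in
/-- The set `Ω'`. Differences are taken in `EReal`, where `x - y` has its usual value whenever
`x` and `y` are not both `-∞` and not both `+∞`. -/
def OmegaPrime (k : ℕ) : Set ((Fin k → ExtInt) × DeltaFreeWord k) :=
  {w | ∀ (i : ℕ) (_ : 1 ≤ i) (hi : i < k),
    let q : EReal := w.1 ⟨i, hi⟩
    let q' : EReal := w.1 ⟨i - 1, by omega⟩
    let m : EReal := ((substringCount k w.2 (k - i) : ℝ≥0∞) : EReal)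
    ¬ (q = ⊥ ∧ q' = ⊥) → ¬ (q = ⊤ ∧ q' = ⊤) →
      m ≤ q - q' ∧ (w.2.1.Terminates → q - q' = m)}

/-- The identifications made in `Ω'`: all points with `p = (+∞, …, +∞)` are equivalent, and so are
all points with `p = (-∞, …, -∞)`. -/
def OmegaRel (k : ℕ) (v w : OmegaPrime k) : Prop :=
  (∀ i, (v.1.1 i : EReal) = ⊤ ∧ (w.1.1 i : EReal) = ⊤) ∨
  (∀ i, (v.1.1 i : EReal) = ⊥ ∧ (w.1.1 i : EReal) = ⊥)

/-- The quotient space `Ω` of `Ω'`, with the quotient topology (`Ω'` has the subspace topology of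
the product topology). -/
abbrev Omega (k : ℕ) : Type := Quot (OmegaRel k)

end

/-! Every element of `A_k` can be written uniquely as w Δ^r, with w a finite positive word having no
alternating block of length k. Encode it as (p, w), where p_0 = r and p_i - p_{i-1} is the number of
maximal alternating substrings of w of length k - i. Left multiplication by a letter x lengthens by
one the alternating prefix of w that starts with the other letter. If this prefix has length l, a
substring of length l becomes one of length l + 1. For l = 0 a substring of length 1 is created, and
for l = k - 1 a Δ arises, which moves to the right end. In these coordinates the only change is that
p_{k-1-l} increases by 1. The rule makes sense for infinite w too, and it gives an action of `A_k`
(`stateHom`) in which p is translated by an integer cocycle depending only on the group element and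
w.

The word length is the ℓ¹ norm of p (`wordLength_eq_coordNorm`): a generator changes one coordinate
by ±1, and if g ≠ 1 some generator moves a coordinate of g towards 0 (`exists_coordNorm_mul_eq`).
Hence φ_g(x) = Σ (|p_i + c_i| - |p_i|), where c is the cocycle of x⁻¹ at w. The summands extend
continuously to p_i = ±∞, and c depends only on a finite prefix of w. So the formula defines a
continuous map `horoMap`, in particular on the compact space Ω'. The points of `A_k` are dense in Ω'
(`mem_closure_range_point`), so the image of Ω' is the horofunction compactification
(`range_horoMap`).

It remains to find the fibres (`eq_or_omegaRel_of_horoMap_eq`). On powers of Δ the cocycle is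
constant, and since p is nondecreasing the values there determine p (`SameHoro.eq`). Suppose two
different words give the same function. For every cut of the index set there are a translate of the
pair and a letter that raises coordinates on opposite sides of the cut (`exists_pushIndex_lt`).
Since the vectors must still agree, both coordinates are infinite, of equal sign, and monotonicity
makes p constant across the cut (`SameHoro.not_lt`). So w is determined unless p is constantly +∞ or
-∞. In those cases the function is, up to sign, the exponent sum, whatever w is. The induced map on
Ω is a continuous bijection from a compact space to a Hausdorff space. -/

namespace DihedralArtin

open Stream'

/-! ### Alternating words -/

/-- The `j`-th letter of the alternating word that starts with `x`. -/
def altLetter (x : Bool) (j : ℕ) : Bool := xor x j.bodd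

@[simp] lemma altLetter_zero (x : Bool) : altLetter x 0 = x := by simp [altLetter]

lemma altLetter_succ (x : Bool) (j : ℕ) : altLetter x (j + 1) = altLetter (!x) j := by
  simp [altLetter]

@[simp] lemma altLetter_not (x : Bool) (j : ℕ) : altLetter (!x) j = !altLetter x j := by
  simp [altLetter]

lemma altLetter_altLetter (x : Bool) (i j : ℕ) :
    altLetter (altLetter x i) j = altLetter x (i + j) := by
  simp [altLetter]

@[simp] lemma altLetter_self (x : Bool) (j : ℕ) : altLetter (altLetter x j) j = x := by
  simp [altLetter]

lemma altLetter_comm (x : Bool) (i j : ℕ) :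
    altLetter (altLetter x i) j = altLetter (altLetter x j) i := by
  rw [altLetter_altLetter, altLetter_altLetter, add_comm]

lemma altLetter_injective (j : ℕ) : Function.Injective fun x => altLetter x j :=
  fun x y h => by simpa using congrArg (fun w => altLetter w j) h

/-- The first `l` letters of `z` exist and alternate, starting with `x`. -/
def StartsAlt (z : Seq Bool) (x : Bool) (l : ℕ) : Prop :=
  ∀ j < l, z.get? j = some (altLetter x j)

lemma startsAlt_zero (z : Seq Bool) (x : Bool) : StartsAlt z x 0 := fun _ h => by omega

lemma StartsAlt.mono {z : Seq Bool} {x : Bool} {l m : ℕ} (h : StartsAlt z x l) (hm : m ≤ l) :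
    StartsAlt z x m := fun j hj => h j (hj.trans_le hm)

lemma StartsAlt.get?_zero {z : Seq Bool} {x : Bool} {l : ℕ} (h : StartsAlt z x l) (hl : l ≠ 0) :
    z.get? 0 = some x := by
  simpa using h 0 (Nat.pos_of_ne_zero hl)

lemma startsAlt_succ_iff {z : Seq Bool} {x : Bool} {l : ℕ} :
    StartsAlt z x (l + 1) ↔ StartsAlt z x l ∧ z.get? l = some (altLetter x l) := by
  refine ⟨fun h => ⟨h.mono l.le_succ, h l l.lt_succ_self⟩, fun h j hj => ?_⟩
  rcases Nat.lt_succ_iff_lt_or_eq.1 hj with h' | rfl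
  exacts [h.1 j h', h.2]

lemma startsAlt_cons_succ {z : Seq Bool} {x y : Bool} {l : ℕ} :
    StartsAlt (Seq.cons x z) y (l + 1) ↔ y = x ∧ StartsAlt z (!y) l := by
  refine ⟨fun h => ⟨?_, fun j hj => ?_⟩, ?_⟩
  · simpa using (h 0 (by omega)).symm
  · rw [← altLetter_succ, ← h (j + 1) (by omega), Seq.get?_cons_succ]
  · rintro ⟨rfl, h⟩ j hj
    cases j with
    | zero => simp
    | succ j => rw [Seq.get?_cons_succ, altLetter_succ, h j (by omega)]

/-- The word `z` preceded by the alternating word of length `l` that starts with `x`. -/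
def prependAlt (x : Bool) : ℕ → Seq Bool → Seq Bool
  | 0, z => z
  | l + 1, z => Seq.cons x (prependAlt (!x) l z)

@[simp] lemma prependAlt_zero (x : Bool) (z : Seq Bool) : prependAlt x 0 z = z := rfl

lemma prependAlt_succ (x : Bool) (l : ℕ) (z : Seq Bool) :
    prependAlt x (l + 1) z = Seq.cons x (prependAlt (!x) l z) := rfl

lemma get?_prependAlt (x : Bool) (l : ℕ) (z : Seq Bool) (j : ℕ) :
    (prependAlt x l z).get? j = if j < l then some (altLetter x j) else z.get? (j - l) := by
  induction l generalizing x j with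
  | zero => simp
  | succ l ih =>
    rw [prependAlt_succ]
    cases j with
    | zero => simp
    | succ j => rw [Seq.get?_cons_succ, ih, altLetter_succ]; simp

lemma get?_prependAlt_add (x : Bool) (l : ℕ) (z : Seq Bool) (j : ℕ) :
    (prependAlt x l z).get? (l + j) = z.get? j := by
  rw [get?_prependAlt]; simp

lemma drop_prependAlt (x : Bool) (l : ℕ) (z : Seq Bool) : (prependAlt x l z).drop l = z :=
  Seq.ext fun n => by rw [Seq.drop_get?, get?_prependAlt_add]

lemma startsAlt_prependAlt (x : Bool) (l : ℕ) (z : Seq Bool) : StartsAlt (prependAlt x l z) x l :=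
  fun j hj => by rw [get?_prependAlt, if_pos hj]

lemma StartsAlt.eq_prependAlt {z : Seq Bool} {x : Bool} {l : ℕ} (h : StartsAlt z x l) :
    z = prependAlt x l (z.drop l) := by
  refine Seq.ext fun n => ?_
  rw [get?_prependAlt, Seq.drop_get?]
  split_ifs with hn
  · exact h n hn
  · congr 1; omega

/-- The effect of conjugation by `Δ` on words: the letters are exchanged if `k` is odd. -/
def twist (k : ℕ) (z : Seq Bool) : Seq Bool := z.map fun x => altLetter x k

lemma get?_twist (k : ℕ) (z : Seq Bool) (n : ℕ) :
    (twist k z).get? n = (z.get? n).map fun x => altLetter x k := Seq.map_get? _ _ _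

@[simp] lemma twist_twist (k : ℕ) (z : Seq Bool) : twist k (twist k z) = z :=
  Seq.ext fun n => by rw [get?_twist, get?_twist, Option.map_map]; simp [Function.comp_def]

lemma get?_twist_eq_some {k : ℕ} {z : Seq Bool} {n : ℕ} {x : Bool} :
    (twist k z).get? n = some (altLetter x k) ↔ z.get? n = some x := by
  rw [get?_twist]
  exact (Option.map_injective (altLetter_injective k)).eq_iff' (by simp)

lemma startsAlt_twist {k : ℕ} {z : Seq Bool} {x : Bool} {l : ℕ} :
    StartsAlt (twist k z) (altLetter x k) l ↔ StartsAlt z x l := by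
  unfold StartsAlt
  simp only [altLetter_comm x k, get?_twist_eq_some]

lemma twist_prependAlt (k : ℕ) (x : Bool) (l : ℕ) (z : Seq Bool) :
    twist k (prependAlt x l z) = prependAlt (altLetter x k) l (twist k z) := by
  refine Seq.ext fun n => ?_
  rw [get?_twist, get?_prependAlt, get?_prependAlt]
  split_ifs
  · rw [Option.map_some, altLetter_comm]
  · rw [get?_twist]

lemma drop_twist (k : ℕ) (z : Seq Bool) (n : ℕ) : (twist k z).drop n = twist k (z.drop n) :=
  Seq.ext fun m => by rw [Seq.drop_get?, get?_twist, get?_twist, Seq.drop_get?]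

lemma twist_terminates {k : ℕ} {z : Seq Bool} (h : z.Terminates) : (twist k z).Terminates := by
  obtain ⟨n, hn⟩ := h
  refine ⟨n, ?_⟩
  rw [Seq.TerminatedAt] at *
  rw [get?_twist, hn, Option.map_none]

/-! ### Words without alternating blocks of length `k` -/

/-- No `k` consecutive letters of `z` alternate. -/
def AltFree (k : ℕ) (z : Seq Bool) : Prop := ∀ n x, ¬ StartsAlt (z.drop n) x k

lemma AltFree.not_startsAlt {k : ℕ} {z : Seq Bool} (h : AltFree k z) (x : Bool) :
    ¬ StartsAlt z x k := h 0 x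

lemma AltFree.drop {k : ℕ} {z : Seq Bool} (h : AltFree k z) (n : ℕ) : AltFree k (z.drop n) := by
  intro m x hx
  refine h (n + m) x fun j hj => ?_
  have := hx j hj
  rwa [Seq.drop_get?, Seq.drop_get?, ← add_assoc, ← Seq.drop_get?] at this

lemma AltFree.twist {k : ℕ} {z : Seq Bool} (h : AltFree k z) : AltFree k (twist k z) := by
  intro n x hx
  rw [drop_twist, ← altLetter_self x k, startsAlt_twist] at hx
  exact h n _ hx

lemma AltFree.cons {k : ℕ} [NeZero k] {z : Seq Bool} {x : Bool} (h : AltFree k z)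
    (hx : ¬ StartsAlt z (!x) (k - 1)) : AltFree k (Seq.cons x z) := by
  obtain ⟨k, rfl⟩ := Nat.exists_eq_succ_of_ne_zero (NeZero.ne k)
  intro n y hy
  cases n with
  | zero =>
    obtain ⟨rfl, h'⟩ := startsAlt_cons_succ.1 hy
    exact hx h'
  | succ n =>
    refine h n y fun j hj => ?_
    rw [← hy j hj, Seq.drop_get?, Seq.drop_get?, Nat.add_right_comm, Seq.get?_cons_succ]

lemma AltFree.prependAlt {k : ℕ} [NeZero k] {z : Seq Bool} {x : Bool} {l : ℕ} (h : AltFree k z)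
    (hl : l ≤ k - 1) (hx : z.get? 0 ≠ some (altLetter x l)) : AltFree k (prependAlt x l z) := by
  induction l generalizing x with
  | zero => exact h
  | succ l ih =>
    rw [altLetter_succ] at hx
    refine (ih (by omega) hx).cons fun h' => hx ?_
    rw [← h' l (by omega), get?_prependAlt]
    simp

lemma altFree_nil (k : ℕ) [NeZero k] : AltFree k Seq.nil := by
  intro n x h
  have := h 0 (Nat.pos_of_ne_zero (NeZero.ne k))
  rw [Seq.drop_get?] at this
  simp at this

open scoped Classical in
/-- The length, up to a maximum of `k - 1`, of the alternating prefix of `z` that starts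
with `x`. -/
noncomputable def leadLength (k : ℕ) (x : Bool) (z : Seq Bool) : ℕ :=
  Nat.findGreatest (StartsAlt z x) (k - 1)

lemma leadLength_le (k : ℕ) (x : Bool) (z : Seq Bool) : leadLength k x z ≤ k - 1 := by
  classical
  exact Nat.findGreatest_le _

lemma startsAlt_leadLength (k : ℕ) (x : Bool) (z : Seq Bool) :
    StartsAlt z x (leadLength k x z) := by
  classical
  exact Nat.findGreatest_spec (P := StartsAlt z x) (Nat.zero_le _) (startsAlt_zero z x)

lemma le_leadLength {k : ℕ} {x : Bool} {z : Seq Bool} {l : ℕ} (hl : l ≤ k - 1)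
    (h : StartsAlt z x l) : l ≤ leadLength k x z := by
  classical
  exact Nat.le_findGreatest hl h

lemma leadLength_prependAlt {k : ℕ} {x : Bool} {z : Seq Bool} {l : ℕ} (hl : l ≤ k - 1)
    (h : z.get? 0 ≠ some (altLetter x l)) : leadLength k x (prependAlt x l z) = l := by
  refine le_antisymm ?_ (le_leadLength hl (startsAlt_prependAlt x l z))
  by_contra! hlt
  have := startsAlt_leadLength k x (prependAlt x l z) l hlt
  exact h ((get?_prependAlt_add x l z 0).symm.trans this)

/-- The cap `k - 1` never cuts an alternating prefix short here: one more alternating letter would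
complete a forbidden block of length `k`. -/
lemma get?_drop_leadLength {k : ℕ} [NeZero k] {z : Seq Bool} (hz : AltFree k z) (x : Bool) :
    (z.drop (leadLength k x z)).get? 0 ≠ some (altLetter x (leadLength k x z)) := by
  intro h
  rw [Seq.drop_get?, add_zero] at h
  have h' := startsAlt_succ_iff.2 ⟨startsAlt_leadLength k x z, h⟩
  rcases (leadLength_le k x z).lt_or_eq with hlt | heq
  · have := le_leadLength (k := k) (by omega) h'
    omega
  · have := NeZero.pos k
    rw [heq, Nat.sub_add_cancel this] at h'
    exact hz.not_startsAlt x h'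

lemma leadLength_eq_zero_iff {k : ℕ} (hk : 2 ≤ k) {x : Bool} {z : Seq Bool} :
    leadLength k x z = 0 ↔ z.get? 0 ≠ some x := by
  refine ⟨fun h hx => ?_, fun h => by_contra fun h' => ?_⟩
  · have : 1 ≤ leadLength k x z := le_leadLength (by omega) (startsAlt_succ_iff.2
      ⟨startsAlt_zero z x, by simpa using hx⟩)
    omega
  · exact h ((startsAlt_leadLength k x z).get?_zero h')

lemma leadLength_eq_max_iff {k : ℕ} {x : Bool} {z : Seq Bool} :
    leadLength k x z = k - 1 ↔ StartsAlt z x (k - 1) := by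
  refine ⟨fun h => h ▸ startsAlt_leadLength k x z, fun h => ?_⟩
  exact le_antisymm (leadLength_le k x z) (le_leadLength le_rfl h)

lemma leadLength_twist (k : ℕ) (x : Bool) (z : Seq Bool) :
    leadLength k (altLetter x k) (twist k z) = leadLength k x z := by
  exact le_antisymm
    (le_leadLength (leadLength_le _ _ _) (startsAlt_twist.1 (startsAlt_leadLength _ _ _)))
    (le_leadLength (leadLength_le _ _ _) (startsAlt_twist.2 (startsAlt_leadLength _ _ _)))

lemma eq_prependAlt_leadLength (k : ℕ) (x : Bool) (z : Seq Bool) :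
    z = prependAlt x (leadLength k x z) (z.drop (leadLength k x z)) :=
  (startsAlt_leadLength k x z).eq_prependAlt

end DihedralArtin

/-! ### Construction of the action and verification of the braid relation. -/

namespace DihedralArtin

open Stream'

/-! ### The action of `A_k` on words -/

open scoped Classical in
/-- Left multiplication of a word by the letter `x`, where `Δ` is moved to the right and dropped. -/
noncomputable def push (k : ℕ) (x : Bool) (z : Seq Bool) : Seq Bool :=
  if leadLength k (!x) z = k - 1 then twist k (z.drop (k - 1)) else Seq.cons x z

open scoped Classical in
/-- Left multiplication of a word by the inverse of the letter `x`, where `Δ⁻¹` is moved to the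
right and dropped. -/
noncomputable def pop (k : ℕ) (x : Bool) (z : Seq Bool) : Seq Bool :=
  -- Since x followed by the alternating product of k - 1 factors starting with the other letter is
  -- Δ, the inverse of x is this product times Δ⁻¹; moving Δ⁻¹ past `z` twists `z`.
  if z.get? 0 = some x then z.tail else prependAlt (!x) (k - 1) (twist k z)

variable {k : ℕ}

lemma push_of_eq {x : Bool} {z : Seq Bool} (h : leadLength k (!x) z = k - 1) :
    push k x z = twist k (z.drop (k - 1)) := if_pos h

lemma push_of_ne {x : Bool} {z : Seq Bool} (h : leadLength k (!x) z ≠ k - 1) :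
    push k x z = Seq.cons x z := if_neg h

lemma pop_of_eq {x : Bool} {z : Seq Bool} (h : z.get? 0 = some x) : pop k x z = z.tail := if_pos h

lemma pop_of_ne {x : Bool} {z : Seq Bool} (h : z.get? 0 ≠ some x) :
    pop k x z = prependAlt (!x) (k - 1) (twist k z) := if_neg h

lemma altLetter_not_pred [NeZero k] (x : Bool) : altLetter (!x) (k - 1) = altLetter x k := by
  rw [← altLetter_succ, Nat.sub_add_cancel (NeZero.pos k)]

lemma cons_tail {z : Seq Bool} {x : Bool} (h : z.get? 0 = some x) : Seq.cons x z.tail = z :=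
  Seq.ext fun n => by cases n <;> simp [h]

lemma AltFree.push [NeZero k] {z : Seq Bool} (h : AltFree k z) (x : Bool) :
    AltFree k (push k x z) := by
  by_cases hx : leadLength k (!x) z = k - 1
  · rw [push_of_eq hx]
    exact (h.drop _).twist
  · rw [push_of_ne hx]
    exact h.cons (mt leadLength_eq_max_iff.2 hx)

lemma AltFree.pop [NeZero k] {z : Seq Bool} (h : AltFree k z) (x : Bool) :
    AltFree k (pop k x z) := by
  by_cases hx : z.get? 0 = some x
  · rw [pop_of_eq hx]
    exact h.drop 1
  · rw [pop_of_ne hx]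
    refine h.twist.prependAlt le_rfl ?_
    rwa [altLetter_not_pred, Ne, get?_twist_eq_some]

lemma pop_push [NeZero k] {z : Seq Bool} (h : AltFree k z) (x : Bool) :
    pop k x (push k x z) = z := by
  by_cases hx : leadLength k (!x) z = k - 1
  · rw [push_of_eq hx, pop_of_ne]
    · rw [twist_twist, ← hx, ← eq_prependAlt_leadLength]
    · rw [← altLetter_self x k, Ne, get?_twist_eq_some, ← altLetter_not_pred, ← hx]
      exact get?_drop_leadLength h _
  · rw [push_of_ne hx, pop_of_eq (by simp), Seq.tail_cons]

lemma push_pop [NeZero k] {z : Seq Bool} (h : AltFree k z) (x : Bool) :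
    push k x (pop k x z) = z := by
  by_cases hx : z.get? 0 = some x
  · rw [pop_of_eq hx, push_of_ne, cons_tail hx]
    intro h'
    rw [leadLength_eq_max_iff] at h'
    have := startsAlt_cons_succ.2 ⟨rfl, h'⟩
    rw [cons_tail hx, Nat.sub_add_cancel (NeZero.pos k)] at this
    exact h.not_startsAlt _ this
  · rw [pop_of_ne hx, push_of_eq, drop_prependAlt, twist_twist]
    exact leadLength_eq_max_iff.2 (startsAlt_prependAlt _ _ _)

variable (k) in
/-- The words without alternating blocks of length `k`. -/
abbrev Word : Type := {z : Seq Bool // AltFree k z}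

/-- The permutation of the words given by left multiplication by `x`. -/
noncomputable def pushEquiv [NeZero k] (x : Bool) : Equiv.Perm (Word k) where
  toFun z := ⟨push k x z.1, z.2.push x⟩
  invFun z := ⟨pop k x z.1, z.2.pop x⟩
  left_inv z := Subtype.ext (pop_push z.2 x)
  right_inv z := Subtype.ext (push_pop z.2 x)

variable (k) in
/-- The pairs of a vector of integers (of which only the first `k` entries matter) and a word. -/
abbrev State : Type := (ℕ → ℤ) × Word k

/-- The index of the coordinate that increases when a word is multiplied by `x`. -/
noncomputable def pushIndex (k : ℕ) (x : Bool) (z : Seq Bool) : ℕ := k - 1 - leadLength k (!x) z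

lemma pushIndex_lt [NeZero k] (x : Bool) (z : Seq Bool) : pushIndex k x z < k := by
  have := NeZero.pos k
  unfold pushIndex
  omega

/-- The effect of left multiplication by `x` on a vector and a word. -/
noncomputable def genState [NeZero k] (x : Bool) : Equiv.Perm (State k) where
  toFun s := (s.1 + Pi.single (pushIndex k x s.2.1) 1, pushEquiv x s.2)
  -- The index is read off from the popped word, because that is the word whose push is being
  -- undone.
  invFun s := (s.1 - Pi.single (pushIndex k x (pop k x s.2.1)) 1, (pushEquiv x).symm s.2)
  left_inv s := by
    refine Prod.ext ?_ ((pushEquiv x).symm_apply_apply s.2)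
    have : pop k x (push k x s.2.1) = s.2.1 := pop_push s.2.2 x
    simp [pushEquiv, this]
  right_inv s := by
    refine Prod.ext ?_ ((pushEquiv x).apply_symm_apply s.2)
    simp [pushEquiv]

lemma genState_apply [NeZero k] (x : Bool) (p : ℕ → ℤ) (z : Word k) :
    genState x (p, z) = (p + Pi.single (pushIndex k x z.1) 1, pushEquiv x z) := rfl

lemma genState_symm_apply [NeZero k] (x : Bool) (p : ℕ → ℤ) (z : Word k) :
    (genState x).symm (p, z) =
      (p - Pi.single (pushIndex k x (pop k x z.1)) 1, (pushEquiv x).symm z) := rfl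

/-! ### Alternating products -/

section Monoid

variable {M N : Type*} [Monoid M] [Monoid N]

/-- The alternating product with `n` factors of the images of letters, starting with `x`. -/
def altProd (f : Bool → M) (x : Bool) (n : ℕ) : M := alternatingProd (f x) (f (!x)) n

@[simp] lemma altProd_zero (f : Bool → M) (x : Bool) : altProd f x 0 = 1 := rfl

lemma altProd_succ (f : Bool → M) (x : Bool) (n : ℕ) :
    altProd f x (n + 1) = f x * altProd f (!x) n := by
  simp [altProd, alternatingProd]

lemma altProd_add (f : Bool → M) (x : Bool) (m n : ℕ) :
    altProd f x (m + n) = altProd f x m * altProd f (altLetter x m) n := by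
  induction m generalizing x with
  | zero => simp
  | succ m ih => rw [Nat.succ_add, altProd_succ, ih, altProd_succ, altLetter_succ, mul_assoc]

lemma map_alternatingProd (φ : M →* N) (s t : M) (n : ℕ) :
    φ (alternatingProd s t n) = alternatingProd (φ s) (φ t) n := by
  induction n generalizing s t with
  | zero => simp [alternatingProd]
  | succ n ih => simp [alternatingProd, ih]

lemma map_altProd (φ : M →* N) (f : Bool → M) (x : Bool) (n : ℕ) :
    φ (altProd f x n) = altProd (fun y => φ (f y)) x n := map_alternatingProd φ _ _ n

end Monoid

/-! ### The action of the group on vectors and words -/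

/-- The indicator vector of `[m, k)`. -/
def upperOnes (k m : ℕ) : ℕ → ℤ := fun i => if m ≤ i ∧ i < k then 1 else 0

lemma upperOnes_succ_add_single {m : ℕ} (h : m < k) :
    upperOnes k (m + 1) + Pi.single m 1 = upperOnes k m := by
  funext i
  simp only [upperOnes, Pi.add_apply, Pi.single_apply]
  split_ifs <;> omega

lemma upperOnes_self : upperOnes k k = 0 := by
  funext i
  simp only [upperOnes, Pi.zero_apply]
  split_ifs <;> omega

/-- The leading substring grows through the lengths 1, …, l, so the coordinates k - 1, …, k - l rise
once each. -/
lemma altProd_genState [NeZero k] {l : ℕ} (hl : l ≤ k - 1) (x : Bool) (p : ℕ → ℤ) (z : Word k)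
    (hx : z.1.get? 0 ≠ some (altLetter x l)) :
    altProd genState x l (p, z) =
      (p + upperOnes k (k - l), ⟨prependAlt x l z.1, z.2.prependAlt hl hx⟩) := by
  have hk := NeZero.pos k
  induction l generalizing x with
  | zero => simp [upperOnes_self]
  | succ l ih =>
    rw [altLetter_succ] at hx
    have hlead := leadLength_prependAlt (k := k) (l := l) (by omega) hx
    rw [altProd_succ, Equiv.Perm.mul_apply, ih (by omega) _ hx, genState_apply]
    refine Prod.ext ?_ (Subtype.ext ?_)
    · simp only [pushIndex, hlead]
      rw [add_assoc, ← upperOnes_succ_add_single (show k - (l + 1) < k by omega)]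
      congr 3 <;> omega
    · exact push_of_ne (by rw [hlead]; omega)

/-- After k - 1 letters the last one completes Δ and raises coordinate 0, so that every coordinate
has risen exactly once. -/
lemma altProd_genState_of_ne [NeZero k] (x : Bool) (p : ℕ → ℤ) (z : Word k)
    (hx : z.1.get? 0 ≠ some (altLetter x k)) :
    altProd genState x k (p, z) = (p + upperOnes k 0, ⟨twist k z.1, z.2.twist⟩) := by
  have hk := NeZero.pos k
  rw [← altLetter_not_pred] at hx
  have hlead := leadLength_prependAlt (k := k) le_rfl hx
  have e : altProd (M := Equiv.Perm (State k)) genState x k =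
      genState x * altProd genState (!x) (k - 1) := by
    rw [← altProd_succ, Nat.sub_add_cancel hk]
  rw [e, Equiv.Perm.mul_apply, altProd_genState le_rfl _ _ _ hx, genState_apply]
  refine Prod.ext ?_ (Subtype.ext ?_)
  · simp only [pushIndex, hlead]
    rw [add_assoc, ← upperOnes_succ_add_single hk]
    congr 3 <;> omega
  · exact (push_of_eq hlead).trans (by rw [drop_prependAlt])

/-- The result does not depend on `x`, which is the braid relation for the action. The previous
lemma covers words that do not continue the alternation; otherwise the offending prefix of `z` is
split off and treated as a further alternating product. -/
lemma altProd_genState_garside [NeZero k] (x : Bool) (p : ℕ → ℤ) (z : Word k) :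
    altProd genState x k (p, z) = (p + upperOnes k 0, ⟨twist k z.1, z.2.twist⟩) := by
  set w := altLetter x k with hw
  set l := leadLength k w z.1 with hl
  have hlk : l ≤ k - 1 := leadLength_le k w z.1
  set z₀ : Word k := ⟨z.1.drop l, z.2.drop l⟩ with hz₀
  have h0 : z₀.1.get? 0 ≠ some (altLetter w l) := get?_drop_leadLength z.2 w
  have h1 : altProd genState w l (p - upperOnes k (k - l), z₀) = (p, z) := by
    rw [altProd_genState hlk w _ z₀ h0, sub_add_cancel]
    exact Prod.ext rfl (Subtype.ext (eq_prependAlt_leadLength k w z.1).symm)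
  -- The alternating product of k + l factors is split after l factors instead of after k, so that
  -- the block of k factors acts on `z₀`, which does not continue the alternation.
  rw [← h1, ← Equiv.Perm.mul_apply, ← altProd_add, add_comm k l, altProd_add,
    Equiv.Perm.mul_apply, altProd_genState_of_ne, altProd_genState hlk]
  · refine Prod.ext ?_ (Subtype.ext ?_)
    · simp only
      abel
    · simp only [hz₀]
      conv_rhs => rw [eq_prependAlt_leadLength k w z.1, twist_prependAlt, hw, altLetter_self]
  · simp only
    rw [← altLetter_self (altLetter x l) k, Ne, get?_twist_eq_some, altLetter_comm]
    exact h0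
  · rw [altLetter_comm]
    exact h0

/-- The action of the group on vectors and words. -/
noncomputable def stateHom (k : ℕ) [NeZero k] : DihedralArtin k →* Equiv.Perm (State k) :=
  PresentedGroup.toGroup (f := genState) (by
    rintro r rfl
    rw [map_mul, map_inv, mul_inv_eq_one, map_alternatingProd, map_alternatingProd]
    simp only [FreeGroup.lift_apply_of]
    exact Equiv.ext fun s =>
      (altProd_genState_garside false s.1 s.2).trans (altProd_genState_garside true s.1 s.2).symm)

@[simp] lemma stateHom_gen [NeZero k] (x : Bool) : stateHom k (gen k x) = genState x :=
  PresentedGroup.toGroup.of _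

lemma stateHom_altProd [NeZero k] (x : Bool) (l : ℕ) :
    stateHom k (altProd (gen k) x l) = altProd genState x l := by
  simp [map_altProd]

lemma altProd_gen_eq_garside (x : Bool) : altProd (gen k) x k = garside k := by
  cases x with
  | false => rfl
  | true =>
    symm
    have := PresentedGroup.one_of_mem (rels := {alternatingProd (FreeGroup.of false)
      (FreeGroup.of true) k * (alternatingProd (FreeGroup.of true) (FreeGroup.of false) k)⁻¹})
      (Set.mem_singleton _)
    rw [map_mul, map_inv, mul_inv_eq_one, map_alternatingProd, map_alternatingProd] at this
    exact this

lemma stateHom_garside [NeZero k] (p : ℕ → ℤ) (z : Word k) :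
    stateHom k (garside k) (p, z) = (p + upperOnes k 0, ⟨twist k z.1, z.2.twist⟩) := by
  rw [← altProd_gen_eq_garside false, stateHom_altProd, altProd_genState_garside]

/-- An induction principle: the group is generated by its two generators. -/
lemma gen_induction {P : DihedralArtin k → Prop} (one : P 1)
    (gen_mul : ∀ x g, P g → P (gen k x * g)) (inv_gen_mul : ∀ x g, P g → P ((gen k x)⁻¹ * g))
    (g : DihedralArtin k) : P g := by
  obtain ⟨l, hl, -, rfl⟩ :=
    exists_word_of_generates (inv_mem_artinGenerators k) (closure_artinGenerators k) g
  induction l with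
  | nil => exact one
  | cons s l ih =>
    rw [List.prod_cons]
    have ih := ih fun x hx => hl x (List.mem_cons_of_mem s hx)
    have hs := hl s List.mem_cons_self
    simp only [artinGenerators, Set.mem_insert_iff, Set.mem_singleton_iff] at hs
    rcases hs with rfl | rfl | rfl | rfl
    exacts [gen_mul _ _ ih, gen_mul _ _ ih, inv_gen_mul _ _ ih, inv_gen_mul _ _ ih]

/-- The word `g z`. -/
noncomputable def act [NeZero k] (g : DihedralArtin k) (z : Word k) : Word k :=
  (stateHom k g (0, z)).2

/-- The increments of the coordinates caused by multiplication of the word `z` by `g`. -/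
noncomputable def cocycle [NeZero k] (g : DihedralArtin k) (z : Word k) : ℕ → ℤ :=
  (stateHom k g (0, z)).1

/-- Which coordinate changes depends on the word only, so the action commutes with translations of
the vector. -/
lemma stateHom_apply [NeZero k] (g : DihedralArtin k) (p : ℕ → ℤ) (z : Word k) :
    stateHom k g (p, z) = (p + cocycle g z, act g z) := by
  suffices ∀ q, stateHom k g (p + q, z) = (p + (stateHom k g (q, z)).1, (stateHom k g (q, z)).2) by
    simpa [cocycle, act] using this 0
  intro q
  induction g using gen_induction with
  | one => simp
  | gen_mul x g ih =>
    simp only [map_mul, Equiv.Perm.mul_apply, ih, stateHom_gen, genState_apply, add_assoc]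
    rfl
  | inv_gen_mul x g ih =>
    simp only [map_mul, map_inv, Equiv.Perm.mul_apply, ih, stateHom_gen]
    rw [Equiv.Perm.inv_def, genState_symm_apply, add_sub_assoc]
    rfl

end DihedralArtin

/-! ### The cocycle, normal forms, and the words of `Z`. -/

namespace DihedralArtin

open Stream'

variable {k : ℕ}

/-! ### Properties of the action and of its cocycle -/

section Cocycle

variable [NeZero k]

@[simp] lemma act_one (z : Word k) : act 1 z = z := by simp [act]

@[simp] lemma cocycle_one (z : Word k) : cocycle 1 z = 0 := by simp [cocycle]

lemma stateHom_mul_apply (g h : DihedralArtin k) (p : ℕ → ℤ) (z : Word k) :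
    stateHom k (g * h) (p, z) = (p + cocycle h z + cocycle g (act h z), act g (act h z)) := by
  rw [map_mul, Equiv.Perm.mul_apply, stateHom_apply, stateHom_apply]

lemma act_mul (g h : DihedralArtin k) (z : Word k) : act (g * h) z = act g (act h z) := by
  rw [act, stateHom_mul_apply]

lemma cocycle_mul (g h : DihedralArtin k) (z : Word k) :
    cocycle (g * h) z = cocycle h z + cocycle g (act h z) := by
  rw [cocycle, stateHom_mul_apply, zero_add]

lemma act_gen (x : Bool) (z : Word k) : act (gen k x) z = pushEquiv x z := by
  simp [act, genState_apply]

lemma cocycle_gen (x : Bool) (z : Word k) :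
    cocycle (gen k x) z = Pi.single (pushIndex k x z.1) 1 := by
  simp [cocycle, genState_apply]

@[simp] lemma act_inv_act (g : DihedralArtin k) (z : Word k) : act g⁻¹ (act g z) = z := by
  rw [← act_mul, inv_mul_cancel, act_one]

@[simp] lemma act_act_inv (g : DihedralArtin k) (z : Word k) : act g (act g⁻¹ z) = z := by
  rw [← act_mul, mul_inv_cancel, act_one]

lemma cocycle_inv (g : DihedralArtin k) (z : Word k) :
    cocycle g⁻¹ z = -cocycle g (act g⁻¹ z) := by
  rw [eq_neg_iff_add_eq_zero, ← cocycle_mul, mul_inv_cancel, cocycle_one]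

lemma act_inv_gen (x : Bool) (z : Word k) : act (gen k x)⁻¹ z = (pushEquiv x).symm z := by
  rw [Equiv.eq_symm_apply, ← act_gen, act_act_inv]

lemma cocycle_inv_gen (x : Bool) (z : Word k) :
    cocycle (gen k x)⁻¹ z = -Pi.single (pushIndex k x (pop k x z.1)) 1 := by
  rw [cocycle_inv, cocycle_gen, act_inv_gen]
  rfl

lemma cocycle_garside (z : Word k) : cocycle (garside k) z = upperOnes k 0 := by
  simp [cocycle, stateHom_garside]

lemma cocycle_garside_zpow (n : ℤ) (z : Word k) {i : ℕ} (hi : i < k) :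
    cocycle (garside k ^ n) z i = n := by
  have h1 : ∀ z : Word k, cocycle (garside k) z i = 1 := fun z => by
    simp [cocycle_garside, upperOnes, hi]
  induction n generalizing z with
  | zero => simp
  | succ n ih => rw [zpow_add_one, cocycle_mul, Pi.add_apply, h1, ih, add_comm]
  | pred n ih =>
    rw [zpow_sub_one, cocycle_mul, Pi.add_apply, cocycle_inv, Pi.neg_apply, h1, ih]
    ring

lemma sum_cocycle_gen (x : Bool) (z : Word k) :
    ∑ i ∈ Finset.range k, cocycle (gen k x) z i = 1 := by
  rw [cocycle_gen]
  simp [pushIndex_lt]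

/-- Both sides are the exponent sum of `g`: each generator contributes 1 at every word. -/
lemma sum_cocycle_eq (g : DihedralArtin k) (z z' : Word k) :
    ∑ i ∈ Finset.range k, cocycle g z i = ∑ i ∈ Finset.range k, cocycle g z' i := by
  induction g using gen_induction generalizing z z' with
  | one => simp
  | gen_mul x g ih =>
    simp only [cocycle_mul, Pi.add_apply, Finset.sum_add_distrib, sum_cocycle_gen, ih z z']
  | inv_gen_mul x g ih =>
    simp only [cocycle_mul, Pi.add_apply, Finset.sum_add_distrib, ih z z', cocycle_inv,
      Pi.neg_apply, Finset.sum_neg_distrib, sum_cocycle_gen]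

omit [NeZero k] in
lemma wordProd_cons (x : Bool) (u : List Bool) :
    wordProd k (x :: u) = gen k x * wordProd k u := by
  simp [wordProd]

lemma sum_cocycle_wordProd (u : List Bool) (z : Word k) :
    ∑ i ∈ Finset.range k, cocycle (wordProd k u) z i = u.length := by
  induction u with
  | nil => simp [wordProd]
  | cons x u ih =>
    simp only [wordProd_cons, cocycle_mul, Pi.add_apply, Finset.sum_add_distrib, sum_cocycle_gen,
      ih, List.length_cons, Nat.cast_add, Nat.cast_one]

end Cocycle

/-! ### Normal forms -/

section NormalForm

/-- An alternating product of k + 1 factors has Δ both as its first k and as its last k factors. -/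
lemma garside_mul_gen (x : Bool) :
    garside k * gen k x = gen k (altLetter x k) * garside k := by
  have h := altProd_succ (gen k) (altLetter x k) k
  rw [altProd_add, altLetter_self, altProd_gen_eq_garside, altProd_gen_eq_garside] at h
  rw [← h]
  simp [altProd_succ]

lemma garside_mul_wordProd (u : List Bool) :
    garside k * wordProd k u = wordProd k (u.map fun x => altLetter x k) * garside k := by
  induction u with
  | nil => simp [wordProd]
  | cons x u ih =>
    rw [List.map_cons, wordProd_cons, wordProd_cons, ← mul_assoc, garside_mul_gen, mul_assoc, ih,
      mul_assoc]

lemma wordProd_eq_altProd_mul {u : List Bool} {x : Bool} {l : ℕ}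
    (h : StartsAlt (Seq.ofList u) x l) :
    wordProd k u = altProd (gen k) x l * wordProd k (u.drop l) := by
  induction l generalizing u x with
  | zero => simp
  | succ l ih =>
    cases u with
    | nil => simpa using h.get?_zero
    | cons y u =>
      rw [Seq.ofList_cons, startsAlt_cons_succ] at h
      obtain ⟨rfl, h⟩ := h
      rw [wordProd_cons, ih h, altProd_succ, mul_assoc, List.drop_succ_cons]

lemma drop_ofList (u : List Bool) (n : ℕ) :
    (Seq.ofList u).drop n = Seq.ofList (u.drop n) :=
  Seq.ext fun m => by rw [Seq.drop_get?, Seq.ofList_get?, Seq.ofList_get?, List.getElem?_drop]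

lemma twist_ofList (u : List Bool) :
    twist k (Seq.ofList u) = Seq.ofList (u.map fun x => altLetter x k) :=
  Seq.ext fun m => by rw [get?_twist, Seq.ofList_get?, Seq.ofList_get?, List.getElem?_map]

lemma exists_eq_ofList {z : Seq Bool} (h : z.Terminates) : ∃ u, z = Seq.ofList u :=
  ⟨_, (Seq.ofList_toList z h).symm⟩

lemma prependAlt_terminates {x : Bool} {l : ℕ} {z : Seq Bool} (h : z.Terminates) :
    (prependAlt x l z).Terminates := by
  induction l generalizing x with
  | zero => exact h
  | succ l ih => exact Seq.terminates_cons_iff.2 ih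

lemma drop_terminates {n : ℕ} {z : Seq Bool} (h : z.Terminates) : (z.drop n).Terminates := by
  obtain ⟨m, hm⟩ := h
  exact ⟨m, by rw [Seq.TerminatedAt, Seq.drop_get?]; exact Seq.le_stable _ (by omega) hm⟩

lemma pop_terminates {x : Bool} {z : Seq Bool} (h : z.Terminates) : (pop k x z).Terminates := by
  unfold pop
  split_ifs
  · exact drop_terminates (n := 1) h
  · exact prependAlt_terminates (twist_terminates h)

/-- The finite word of `s`, multiplied by the power of `Δ` given by the zeroth coordinate of `s`,
represents `g`. -/
def Represents (s : State k) (g : DihedralArtin k) : Prop :=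
  ∃ u : List Bool, s.2.1 = Seq.ofList u ∧ g = wordProd k u * garside k ^ s.1 0

lemma Represents.unique {s : State k} {g h : DihedralArtin k} (hg : Represents s g)
    (hh : Represents s h) : g = h := by
  obtain ⟨u, hu, rfl⟩ := hg
  obtain ⟨v, hv, rfl⟩ := hh
  rw [Seq.ofList_injective (hu.symm.trans hv)]

lemma Represents.terminates {s : State k} {g : DihedralArtin k} (hg : Represents s g) :
    s.2.1.Terminates := by
  obtain ⟨u, hu, -⟩ := hg
  exact hu ▸ Seq.terminates_ofList u

variable [NeZero k]

variable (k) in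
/-- The empty word. -/
def nilWord : Word k := ⟨Seq.nil, altFree_nil k⟩

/-- The action computes normal forms. The zeroth coordinate is the exponent of Δ, and it rises
exactly when the new letter completes a Δ. -/
lemma Represents.genState {s : State k} {g : DihedralArtin k} (hg : Represents s g) (x : Bool) :
    Represents (genState x s) (gen k x * g) := by
  have hk := NeZero.pos k
  obtain ⟨p, z⟩ := s
  obtain ⟨u, hu, rfl⟩ := hg
  rw [genState_apply]
  simp only at hu
  by_cases hx : leadLength k (!x) z.1 = k - 1
  · refine ⟨(u.drop (k - 1)).map fun x => altLetter x k, ?_, ?_⟩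
    · exact (push_of_eq hx).trans (by rw [hu, drop_ofList, twist_ofList])
    · have h0 : pushIndex k x z.1 = 0 := by simp [pushIndex, hx]
      rw [wordProd_eq_altProd_mul (hu ▸ leadLength_eq_max_iff.1 hx), ← mul_assoc, ← mul_assoc,
        ← altProd_succ, Nat.sub_add_cancel hk, altProd_gen_eq_garside, garside_mul_wordProd,
        mul_assoc, ← zpow_one_add, h0]
      simp [add_comm]
  · refine ⟨x :: u, ?_, ?_⟩
    · exact (push_of_ne hx).trans (by rw [hu, Seq.ofList_cons])
    · have h0 : 0 ≠ pushIndex k x z.1 := by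
        have := leadLength_le k (!x) z.1
        unfold pushIndex
        omega
      rw [wordProd_cons, mul_assoc]
      simp [Pi.single_eq_of_ne h0]

/-- The popped state represents some element because its word is finite; pushing it forward again
and using uniqueness identifies that element. -/
lemma Represents.genState_symm {s : State k} {g : DihedralArtin k} (hg : Represents s g)
    (x : Bool) : Represents ((DihedralArtin.genState x).symm s) ((gen k x)⁻¹ * g) := by
  have ht : ((DihedralArtin.genState x).symm s).2.1.Terminates := pop_terminates hg.terminates
  obtain ⟨u, hu⟩ := exists_eq_ofList ht
  have h' : Represents ((DihedralArtin.genState x).symm s) _ := ⟨u, hu, rfl⟩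
  have := h'.genState x
  rw [Equiv.apply_symm_apply] at this
  rwa [hg.unique this, inv_mul_cancel_left]

lemma Represents.stateHom {s : State k} {h : DihedralArtin k} (hs : Represents s h)
    (g : DihedralArtin k) : Represents (stateHom k g s) (g * h) := by
  induction g using gen_induction with
  | one => simpa
  | gen_mul x g ih =>
    rw [map_mul, Equiv.Perm.mul_apply, stateHom_gen, mul_assoc]
    exact ih.genState x
  | inv_gen_mul x g ih =>
    rw [map_mul, map_inv, Equiv.Perm.mul_apply, stateHom_gen, mul_assoc]
    exact ih.genState_symm x

lemma represents_nilWord (g : DihedralArtin k) :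
    Represents (cocycle g (nilWord k), act g (nilWord k)) g := by
  have h : Represents ((0, nilWord k) : State k) 1 := ⟨[], rfl, by simp [wordProd]⟩
  simpa [stateHom_apply] using h.stateHom g

/-- An element is recovered from its normal form, so the state of the identity belongs to the
identity alone. -/
lemma eq_one_of_act_nilWord {g : DihedralArtin k} (h : act g (nilWord k) = nilWord k)
    (h0 : cocycle g (nilWord k) 0 = 0) : g = 1 := by
  obtain ⟨u, hu, hg⟩ := represents_nilWord g
  have : Seq.ofList u = Seq.ofList [] := by rw [← hu, h]; rfl
  rw [Seq.ofList_injective this] at hg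
  simpa [wordProd, h0] using hg

/-- Reading `u` from the right, no letter ever completes a block of length `k`, so each push just
prepends. -/
lemma act_wordProd {u : List Bool} (hu : AltFree k (Seq.ofList u)) :
    act (wordProd k u) (nilWord k) = ⟨Seq.ofList u, hu⟩ := by
  induction u with
  | nil => simp [wordProd]; rfl
  | cons x u ih =>
    have hu' : AltFree k (Seq.ofList u) := by
      have := hu.drop 1
      rwa [drop_ofList] at this
    rw [wordProd_cons, act_mul, ih hu', act_gen]
    refine Subtype.ext ((push_of_ne fun h => ?_).trans (Seq.ofList_cons x u).symm)
    have := startsAlt_cons_succ.2 ⟨rfl, leadLength_eq_max_iff.1 h⟩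
    rw [Nat.sub_add_cancel (NeZero.pos k), ← Seq.ofList_cons] at this
    exact hu.not_startsAlt x this

/-! ### The words of `Z` and the set `M⁺` -/

/-- The alternating word of length `l` that starts with `x`. -/
def altList (x : Bool) (l : ℕ) : List Bool := (List.range l).map (altLetter x)

@[simp] lemma length_altList (x : Bool) (l : ℕ) : (altList x l).length = l := by simp [altList]

lemma getElem?_altList {x : Bool} {l j : ℕ} (h : j < l) :
    (altList x l)[j]? = some (altLetter x j) := by
  simp [altList, h]

lemma altList_succ (x : Bool) (l : ℕ) : altList x (l + 1) = x :: altList (!x) l := by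
  simp [altList, List.range_succ_eq_map, Function.comp_def, altLetter_succ]

omit [NeZero k] in
lemma wordProd_altList (x : Bool) (l : ℕ) : wordProd k (altList x l) = altProd (gen k) x l := by
  induction l generalizing x with
  | zero => simp [altList, wordProd]
  | succ l ih => rw [altList_succ, wordProd_cons, ih, altProd_succ]

omit [NeZero k] in
lemma altFree_ofList_of_length_lt {u : List Bool} (hu : u.length < k) :
    AltFree k (Seq.ofList u) := by
  intro n x h
  have := h (k - 1) (by omega)
  rw [Seq.drop_get?, Seq.ofList_get?, List.getElem?_eq_none (by omega)] at this
  simp at this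

/-- For the harder direction, let a subword `u` have product Δ. It is itself free of alternating
blocks of length `k`, so it is recovered from its action on the empty word. But Δ fixes the empty
word, so `u` is empty, contradicting the exponent sum k of Δ. -/
lemma altFree_iff {z : Seq Bool} :
    (∀ (n : ℕ) (u : List Bool), OccursAt z n u → wordProd k u ≠ garside k) ↔ AltFree k z := by
  refine ⟨fun h n x hx => ?_, fun h n u hu hg => ?_⟩
  · refine h n (altList x k) (fun j hj => ?_) ?_
    · rw [length_altList] at hj
      rw [getElem?_altList hj, ← hx j hj, Seq.drop_get?]
    · rw [wordProd_altList, altProd_gen_eq_garside]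
  · have hfree : AltFree k (Seq.ofList u) := by
      intro m x hx
      refine h (n + m) x fun j hj => ?_
      have h1 := hx j hj
      rw [Seq.drop_get?, Seq.ofList_get?] at h1
      obtain ⟨hlt, -⟩ := List.getElem?_eq_some_iff.1 h1
      rw [Seq.drop_get?, ← h1, ← hu _ hlt, add_assoc]
    have hact := act_wordProd hfree
    have hnil : act (garside k) (nilWord k) = nilWord k := by
      simp only [act, stateHom_garside]
      exact Subtype.ext (Seq.ext fun n => by rw [get?_twist]; simp [nilWord])
    rw [hg, hnil] at hact
    have hu0 : u = [] := Seq.ofList_injective (congrArg Subtype.val hact).symm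
    have hlen := sum_cocycle_wordProd (k := k) u (nilWord k)
    rw [hg, hu0] at hlen
    have hk := NeZero.pos k
    simp [cocycle_garside, upperOnes, Finset.filter_true_of_mem] at hlen
    omega

/-- The exponent sum shows that a word with product in M⁺ has fewer than k letters. Such words
contain no block of length `k`, so the action on the empty word recovers them from their products.
-/
lemma wordProd_mem_Mplus {u : List Bool} :
    wordProd k u ∈ Mplus k ↔ ∃ x l, 1 ≤ l ∧ l < k ∧ u = altList x l := by
  constructor
  · rintro ⟨l, hl, hlk, x, hu⟩
    refine ⟨x, l, hl, hlk, ?_⟩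
    replace hu : wordProd k u = wordProd k (altList x l) := hu.trans (wordProd_altList x l).symm
    have hlen := sum_cocycle_wordProd (k := k) u (nilWord k)
    rw [hu, sum_cocycle_wordProd, length_altList] at hlen
    have hfree : AltFree k (Seq.ofList u) := altFree_ofList_of_length_lt (by omega)
    have hfree' : AltFree k (Seq.ofList (altList x l)) :=
      altFree_ofList_of_length_lt (by simpa using hlk)
    have h := act_wordProd hfree
    rw [hu, act_wordProd hfree'] at h
    exact Seq.ofList_injective (congrArg Subtype.val h).symm
  · rintro ⟨x, l, hl, hlk, rfl⟩
    exact ⟨l, hl, hlk, x, wordProd_altList x l⟩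

end NormalForm

end DihedralArtin

/-! ### Substring counts and the invariance of the inequalities defining Ω'. -/

namespace DihedralArtin

open Stream'

variable {k : ℕ}

/-! ### The maximal alternating substrings of a word -/

/-- The length of the first maximal alternating substring. -/
noncomputable def runLength (k : ℕ) (z : Seq Bool) : ℕ :=
  leadLength k false z + leadLength k true z

/-- The word without its first maximal alternating substring. -/
noncomputable def dropRun (k : ℕ) (z : Seq Bool) : Seq Bool := z.drop (runLength k z)

/-- The number of maximal alternating substrings of length `i`. -/
noncomputable def runCount (k : ℕ) (z : Seq Bool) (i : ℕ) : ℕ∞ :=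
  {n : ℕ | runLength k ((dropRun k)^[n] z) = i}.encard

/-- At most one summand in `runLength` is nonzero, since a word has only one first letter. -/
lemma runLength_of_get? (hk : 2 ≤ k) {x : Bool} {z : Seq Bool} (h : z.get? 0 = some x) :
    runLength k z = leadLength k x z := by
  have h' : leadLength k (!x) z = 0 := (leadLength_eq_zero_iff hk).2 (by rw [h]; simp)
  cases x <;> simp_all [runLength]

lemma runLength_eq_zero_iff (hk : 2 ≤ k) {z : Seq Bool} : runLength k z = 0 ↔ z = Seq.nil := by
  rw [← Seq.get?_zero_eq_none, runLength, Nat.add_eq_zero_iff, leadLength_eq_zero_iff hk,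
    leadLength_eq_zero_iff hk]
  rcases z.get? 0 with _ | _ | _ <;> simp

lemma runLength_nil (hk : 2 ≤ k) : runLength k Seq.nil = 0 := (runLength_eq_zero_iff hk).2 rfl

lemma dropRun_nil : dropRun k Seq.nil = Seq.nil :=
  Seq.ext fun n => by rw [dropRun, Seq.drop_get?]; simp

lemma runLength_twist (z : Seq Bool) : runLength k (twist k z) = runLength k z := by
  have h1 := leadLength_twist k false z
  have h2 := leadLength_twist k true z
  have h3 : altLetter true k = !altLetter false k := altLetter_not false k
  rw [h3] at h2
  unfold runLength
  rcases h : altLetter false k with _ | _ <;> rw [h] at h1 h2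
  · exact congrArg₂ _ h1 h2
  · rw [add_comm]
    exact congrArg₂ _ h1 h2

lemma dropRun_twist (z : Seq Bool) : dropRun k (twist k z) = twist k (dropRun k z) := by
  rw [dropRun, runLength_twist, drop_twist, dropRun]

lemma runCount_twist (z : Seq Bool) (i : ℕ) : runCount k (twist k z) i = runCount k z i := by
  have h : ∀ n, (dropRun k)^[n] (twist k z) = twist k ((dropRun k)^[n] z) := fun n =>
    ((show Function.Commute (dropRun k) (twist k) from dropRun_twist).iterate_left n) z
  simp only [runCount, h, runLength_twist]

lemma runCount_eq_add (z : Seq Bool) (i : ℕ) :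
    runCount k z i = (if runLength k z = i then 1 else 0) + runCount k (dropRun k z) i := by
  have hdisj : Disjoint {n : ℕ | n = 0 ∧ runLength k z = i}
      (Nat.succ '' {n : ℕ | runLength k ((dropRun k)^[n] (dropRun k z)) = i}) := by
    rw [Set.disjoint_left]
    rintro n ⟨rfl, -⟩ ⟨m, -, hm⟩
    exact Nat.succ_ne_zero m hm
  have hset : {n : ℕ | runLength k ((dropRun k)^[n] z) = i} =
      {n : ℕ | n = 0 ∧ runLength k z = i} ∪
        Nat.succ '' {n : ℕ | runLength k ((dropRun k)^[n] (dropRun k z)) = i} := by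
    ext n
    cases n with
    | zero => simp
    | succ n => simp [Function.iterate_succ_apply]
  rw [runCount, hset, Set.encard_union_eq hdisj, Nat.succ_injective.encard_image, runCount]
  congr 1
  split_ifs with h <;> simp [h]

lemma runLength_prependAlt (hk : 2 ≤ k) {x : Bool} {l : ℕ} {z : Seq Bool} (hl0 : l ≠ 0)
    (hl : l ≤ k - 1) (hx : z.get? 0 ≠ some (altLetter x l)) :
    runLength k (prependAlt x l z) = l := by
  rw [runLength_of_get? hk ((startsAlt_prependAlt x l z).get?_zero hl0),
    leadLength_prependAlt hl hx]

lemma dropRun_prependAlt (hk : 2 ≤ k) {x : Bool} {l : ℕ} {z : Seq Bool} (hl0 : l ≠ 0)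
    (hl : l ≤ k - 1) (hx : z.get? 0 ≠ some (altLetter x l)) :
    dropRun k (prependAlt x l z) = z := by
  rw [dropRun, runLength_prependAlt hk hl0 hl hx, drop_prependAlt]

lemma runCount_prependAlt (hk : 2 ≤ k) {x : Bool} {l i : ℕ} {z : Seq Bool} (hi : i ≠ 0)
    (hl : l ≤ k - 1) (hx : z.get? 0 ≠ some (altLetter x l)) :
    runCount k (prependAlt x l z) i = (if l = i then 1 else 0) + runCount k z i := by
  rcases eq_or_ne l 0 with rfl | hl0
  · simp [hi.symm]
  · rw [runCount_eq_add, runLength_prependAlt hk hl0 hl hx, dropRun_prependAlt hk hl0 hl hx]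

lemma runCount_nil (hk : 2 ≤ k) {i : ℕ} (hi : i ≠ 0) : runCount k Seq.nil i = 0 := by
  have h : ∀ n, (dropRun k)^[n] Seq.nil = Seq.nil := fun n =>
    Function.iterate_fixed dropRun_nil n
  simp only [runCount, h, runLength_nil hk]
  simp [hi.symm]

lemma runCount_ne_top (hk : 2 ≤ k) {i : ℕ} (hi : i ≠ 0) {z : Seq Bool} (hz : z.Terminates) :
    runCount k z i ≠ ⊤ := by
  obtain ⟨u, rfl⟩ := exists_eq_ofList hz
  induction hn : u.length using Nat.strong_induction_on generalizing u with
  | _ n ih =>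
    by_cases h0 : u = []
    · rw [h0, Seq.ofList_nil, runCount_nil hk hi]
      exact ENat.zero_ne_top
    · have h1 : runLength k (Seq.ofList u) ≠ 0 := by
        rw [Ne, runLength_eq_zero_iff hk, ← Seq.ofList_nil]
        exact fun h => h0 (Seq.ofList_injective h)
      have h2 := List.length_pos_iff.2 h0
      have h3 := ih (u.drop (runLength k (Seq.ofList u))).length
        (by rw [List.length_drop]; omega) _ (Seq.terminates_ofList _) rfl
      rw [runCount_eq_add, dropRun, drop_ofList]
      generalize runCount k _ i = m at h3 ⊢
      lift m to ℕ using h3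
      split_ifs
      · exact ENat.natCast_ne_top (1 + m)
      · exact ENat.natCast_ne_top (0 + m)

/-- The quantity p_{i+1} - p_i - m_{k-i-1} is invariant under a push: with l the prefix length, m_l
loses one and m_{l+1} gains one, while coordinate k - 1 - l rises. At l = 0 and l = k - 1 one of the
two counts lies outside the range considered. -/
lemma runCount_push [NeZero k] (hk : 2 ≤ k) {z : Seq Bool} (hz : AltFree k z) (x : Bool) {i : ℕ}
    (hi : i + 1 < k) :
    (if i + 1 = pushIndex k x z then 1 else 0) + runCount k z (k - (i + 1)) =
      (if i = pushIndex k x z then 1 else 0) + runCount k (push k x z) (k - (i + 1)) := by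
  obtain ⟨l, hl⟩ : ∃ l, l = leadLength k (!x) z := ⟨_, rfl⟩
  obtain ⟨z₀, hz₀⟩ : ∃ z₀, z₀ = z.drop l := ⟨_, rfl⟩
  have hlk : l ≤ k - 1 := hl ▸ leadLength_le k (!x) z
  have h0 : z₀.get? 0 ≠ some (altLetter (!x) l) := by
    rw [hz₀, hl]; exact get?_drop_leadLength hz _
  have hz' : z = prependAlt (!x) l z₀ := by rw [hz₀, hl]; exact eq_prependAlt_leadLength k _ z
  have hcount := runCount_prependAlt hk (i := k - (i + 1)) (by omega) hlk h0
  rw [← hz'] at hcount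
  rw [hcount, pushIndex, ← hl, ← add_assoc]
  by_cases hmax : l = k - 1
  · rw [push_of_eq (hl.symm.trans hmax), ← hmax, ← hz₀, runCount_twist]
    congr 1
    split_ifs <;> first | omega | rfl
  · rw [push_of_ne (fun h => hmax (hl.trans h)), hz', ← prependAlt_succ,
      runCount_prependAlt hk (by omega) (by omega) (by rwa [altLetter_succ]), ← add_assoc]
    congr 1
    split_ifs <;> first | omega | rfl

/-! ### Admissible vectors -/

/-- The sum of a vector of extended numbers and a vector of integers. -/
noncomputable def shift (p : ℕ → EReal) (c : ℕ → ℤ) : ℕ → EReal := fun i =>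
  p i + ((c i : ℝ) : EReal)

/-- An extended natural number as an element of `[-∞, +∞]`. -/
noncomputable abbrev countCoe (m : ℕ∞) : EReal := ((m : ℝ≥0∞) : EReal)

lemma countCoe_add (m n : ℕ∞) : countCoe (m + n) = countCoe m + countCoe n := by
  simp [countCoe]

lemma countCoe_natCast (n : ℕ) : countCoe n = ((n : ℝ) : EReal) := by
  rw [countCoe, ENat.toENNReal_coe, EReal.coe_natCast]
  rfl

@[simp] lemma countCoe_zero : countCoe 0 = 0 := by simp [countCoe]

@[simp] lemma countCoe_one : countCoe 1 = 1 := by simp [countCoe]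

lemma shift_shift (p : ℕ → EReal) (c d : ℕ → ℤ) : shift (shift p c) d = shift p (c + d) := by
  funext i
  simp [shift, add_assoc]

@[simp] lemma shift_zero (p : ℕ → EReal) : shift p 0 = p := by
  funext i
  simp [shift]

/-- The differences of consecutive coordinates of `p` are related by `R` to the numbers of maximal
alternating substrings of `z`. -/
def Admissible (k : ℕ) (R : EReal → EReal → Prop) (p : ℕ → EReal) (z : Seq Bool) : Prop :=
  ∀ i, i + 1 < k → R (p i + countCoe (runCount k z (k - (i + 1)))) (p (i + 1))

/-- Invariance of a relation under addition of real numbers. -/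
def IsShiftInvariant (R : EReal → EReal → Prop) : Prop :=
  ∀ (P Q : EReal) (r : ℝ), R (P + r) (Q + r) ↔ R P Q

lemma isShiftInvariant_le : IsShiftInvariant (· ≤ ·) := by
  intro P Q r
  refine ⟨fun h => ?_, fun h => add_le_add_left h _⟩
  have := add_le_add_left h (-(r : EReal))
  rwa [← sub_eq_add_neg, ← sub_eq_add_neg, EReal.add_sub_cancel_right,
    EReal.add_sub_cancel_right] at this

lemma isShiftInvariant_eq : IsShiftInvariant (· = ·) := by
  intro P Q r
  refine ⟨fun h => ?_, fun h => by simp only [h]⟩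
  have := congrArg (· - (r : EReal)) h
  simpa only [EReal.add_sub_cancel_right] using this

section

variable [NeZero k] {R : EReal → EReal → Prop}

lemma admissible_act_gen_iff (hk : 2 ≤ k) (hR : IsShiftInvariant R) (x : Bool) (p : ℕ → EReal)
    (z : Word k) :
    Admissible k R (shift p (cocycle (gen k x) z)) (act (gen k x) z).1 ↔
      Admissible k R p z.1 := by
  refine forall₂_congr fun i hi => ?_
  have h := congrArg countCoe (runCount_push hk z.2 x hi)
  have e : ∀ i, ((cocycle (gen k x) z i : ℝ) : EReal) =
      countCoe (if i = pushIndex k x z.1 then 1 else 0) := fun i => by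
    rw [cocycle_gen, Pi.single_apply]
    split_ifs <;> simp
  rw [countCoe_add, countCoe_add, ← e, ← e] at h
  rw [act_gen]
  simp only [shift]
  rw [add_assoc]
  erw [← h]
  rw [add_comm (_ : EReal) (countCoe _), ← add_assoc]
  exact hR _ _ _

lemma admissible_act_iff (hk : 2 ≤ k) (hR : IsShiftInvariant R) (g : DihedralArtin k)
    (p : ℕ → EReal) (z : Word k) :
    Admissible k R (shift p (cocycle g z)) (act g z).1 ↔ Admissible k R p z.1 := by
  induction g using gen_induction generalizing p z with
  | one => simp
  | gen_mul x g ih =>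
    rw [cocycle_mul, act_mul, ← shift_shift, admissible_act_gen_iff hk hR, ih]
  | inv_gen_mul x g ih =>
    rw [cocycle_mul, act_mul, ← shift_shift, ← admissible_act_gen_iff hk hR x, act_act_inv,
      shift_shift, cocycle_inv, neg_add_cancel, shift_zero, ih]

lemma admissible_nilWord (hk : 2 ≤ k) (r : EReal) :
    Admissible k (· = ·) (fun _ => r) (nilWord k).1 := by
  intro i hi
  rw [show (nilWord k).1 = Seq.nil from rfl, runCount_nil hk (by omega)]
  simp

/-- The zero vector with the empty word is admissible with equality, and `g` carries this to its own
normal form. -/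
lemma cocycle_succ (hk : 2 ≤ k) (g : DihedralArtin k) {i : ℕ} (hi : i + 1 < k) :
    ((cocycle g (nilWord k) i : ℝ) : EReal) +
        countCoe (runCount k (act g (nilWord k)).1 (k - (i + 1))) =
      ((cocycle g (nilWord k) (i + 1) : ℝ) : EReal) := by
  have h := (admissible_act_iff hk isShiftInvariant_eq g _ _).2 (admissible_nilWord hk 0) i hi
  simpa [shift] using h

end

end DihedralArtin

namespace DihedralArtin

open Stream'

variable {k : ℕ}

/-! ### The length of an element of the group -/

lemma sum_abs_add_single (p : ℕ → ℤ) {j : ℕ} (hj : j < k) (e : ℤ) :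
    ∑ i ∈ Finset.range k, |(p + Pi.single j e : ℕ → ℤ) i| =
      ∑ i ∈ Finset.range k, |p i| - |p j| + |p j + e| := by
  have hj' := Finset.mem_range.2 hj
  rw [← Finset.add_sum_erase _ _ hj', ← Finset.add_sum_erase _ (fun i => |p i|) hj']
  have : ∑ i ∈ (Finset.range k).erase j, |(p + Pi.single j e : ℕ → ℤ) i| =
      ∑ i ∈ (Finset.range k).erase j, |p i| :=
    Finset.sum_congr rfl fun i hi => by simp [Pi.single_eq_of_ne (Finset.ne_of_mem_erase hi)]
  rw [this]
  simp
  ring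

variable [NeZero k]

/-- The sum of the absolute values of the first `k` coordinates of the cocycle at the empty word. -/
noncomputable def coordNorm (g : DihedralArtin k) : ℤ :=
  ∑ i ∈ Finset.range k, |cocycle g (nilWord k) i|

lemma cocycle_of_mem {s : DihedralArtin k} (hs : s ∈ artinGenerators k) (z : Word k) :
    ∃ j < k, ∃ e : ℤ, |e| = 1 ∧ cocycle s z = Pi.single j e := by
  have h1 : ∀ x, ∃ j < k, ∃ e : ℤ, |e| = 1 ∧ cocycle (gen k x) z = Pi.single j e := fun x =>
    ⟨_, pushIndex_lt x z.1, 1, by simp, cocycle_gen x z⟩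
  have h2 : ∀ x, ∃ j < k, ∃ e : ℤ, |e| = 1 ∧ cocycle (gen k x)⁻¹ z = Pi.single j e := fun x =>
    ⟨_, pushIndex_lt x (pop k x z.1), -1, by simp, by rw [cocycle_inv_gen, Pi.single_neg]⟩
  rcases hs with rfl | rfl | rfl | rfl
  exacts [h1 _, h1 _, h2 _, h2 _]

/-- Each generator changes a single coordinate, by ±1; this is the lower bound for the word length.
-/
lemma coordNorm_list_prod_le {l : List (DihedralArtin k)} (hl : ∀ s ∈ l, s ∈ artinGenerators k) :
    coordNorm l.prod ≤ l.length := by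
  induction l with
  | nil => simp [coordNorm]
  | cons s l ih =>
    obtain ⟨j, hj, e, he, hc⟩ :=
      cocycle_of_mem (hl s List.mem_cons_self) (act l.prod (nilWord k))
    have ih := ih fun t ht => hl t (List.mem_cons_of_mem s ht)
    have := abs_add_le (cocycle l.prod (nilWord k) j) e
    rw [coordNorm, List.prod_cons, cocycle_mul, hc, sum_abs_add_single _ hj, ← coordNorm]
    push_cast [List.length_cons]
    omega

/-- The leading substring itself is counted in the difference of these two coordinates. -/
lemma cocycle_pred_lt (hk : 2 ≤ k) (g : DihedralArtin k) {x : Bool}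
    (hx : (act g (nilWord k)).1.get? 0 = some x) :
    cocycle g (nilWord k) (k - 1 - leadLength k x (act g (nilWord k)).1) <
      cocycle g (nilWord k) (k - leadLength k x (act g (nilWord k)).1) := by
  set z := act g (nilWord k)
  set l := leadLength k x z.1
  have hl : l ≤ k - 1 := leadLength_le _ _ _
  have hl0 : l ≠ 0 := fun h => (leadLength_eq_zero_iff hk).1 h hx
  have h := cocycle_succ hk g (i := k - 1 - l) (by omega)
  rw [show k - (k - 1 - l + 1) = l by omega, show k - 1 - l + 1 = k - l by omega] at h
  have hm : (1 : ℕ∞) ≤ runCount k z.1 l := by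
    rw [runCount_eq_add, if_pos (runLength_of_get? hk hx)]
    exact self_le_add_right _ _
  have hm' : ((1 : ℝ) : EReal) ≤ countCoe (runCount k z.1 l) := by
    rw [EReal.coe_one, ← countCoe_one]
    exact EReal.coe_ennreal_le_coe_ennreal_iff.2 (ENat.toENNReal_le.2 hm)
  have h2 := add_le_add_right hm' ((cocycle g (nilWord k) (k - 1 - l) : ℝ) : EReal)
  rw [h, ← EReal.coe_add, EReal.coe_le_coe_iff] at h2
  have h3 : cocycle g (nilWord k) (k - 1 - l) + 1 ≤ cocycle g (nilWord k) (k - l) := by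
    exact_mod_cast h2
  omega

lemma pushIndex_pop_of_get? (hk : 2 ≤ k) {x : Bool} {z : Seq Bool} (hz : AltFree k z)
    (hx : z.get? 0 = some x) : pushIndex k x (pop k x z) = k - leadLength k x z := by
  obtain ⟨l, hl⟩ := Nat.exists_eq_succ_of_ne_zero fun h => (leadLength_eq_zero_iff hk).1 h hx
  have hlk := leadLength_le k x z
  have h0 := get?_drop_leadLength hz x
  rw [pop_of_eq hx]
  conv_lhs => rw [eq_prependAlt_leadLength k x z]
  rw [hl] at h0 ⊢
  rw [Nat.succ_eq_add_one, altLetter_succ] at h0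
  rw [prependAlt_succ, Seq.tail_cons, pushIndex, leadLength_prependAlt (by omega) h0]
  omega

/-- Let the word of `g` start with x and a substring of length l. Then p_{k-1-l} < p_{k-l}: either
p_{k-1-l} < 0, and pushing the other letter raises it, or p_{k-l} > 0, and popping x lowers it. For
the empty word all coordinates are equal and nonzero, and either letter or its inverse works. -/
lemma exists_coordNorm_mul_eq (hk : 2 ≤ k) {g : DihedralArtin k} (hg : g ≠ 1) :
    ∃ s ∈ artinGenerators k, coordNorm (s * g) = coordNorm g - 1 := by
  set z := act g (nilWord k) with hz
  set p := cocycle g (nilWord k) with hp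
  have hpos : ∀ x, p (pushIndex k x z.1) < 0 → coordNorm (gen k x * g) = coordNorm g - 1 := by
    intro x hx
    rw [coordNorm, cocycle_mul, cocycle_gen, sum_abs_add_single _ (pushIndex_lt (k := k) x _),
      ← coordNorm, ← hp, ← hz, abs_of_neg hx, abs_of_nonpos (by omega)]
    ring
  have hneg : ∀ x, 0 < p (pushIndex k x (pop k x z.1)) →
      coordNorm ((gen k x)⁻¹ * g) = coordNorm g - 1 := by
    intro x hx
    rw [coordNorm, cocycle_mul, cocycle_inv_gen, ← Pi.single_neg,
      sum_abs_add_single _ (pushIndex_lt (k := k) x _), ← coordNorm,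
      ← hp, ← hz, abs_of_pos hx, abs_of_nonneg (by omega)]
    ring
  have hmem : ∀ x, gen k x ∈ artinGenerators k := fun x => by
    cases x <;> simp [artinGenerators]
  suffices ∃ x, p (pushIndex k x z.1) < 0 ∨ 0 < p (pushIndex k x (pop k x z.1)) by
    obtain ⟨x, hx | hx⟩ := this
    exacts [⟨_, hmem x, hpos x hx⟩, ⟨_, inv_mem_artinGenerators k _ (hmem x), hneg x hx⟩]
  rcases hz0 : z.1.get? 0 with _ | x
  · have hnil : z = nilWord k := Subtype.ext (Seq.get?_zero_eq_none.1 hz0)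
    have hconst : ∀ i < k, p i = p 0 := by
      intro i hi
      induction i with
      | zero => rfl
      | succ i ih =>
        have h := cocycle_succ hk g hi
        rw [← hz, hnil, show (nilWord k).1 = Seq.nil from rfl, runCount_nil hk (by omega),
          countCoe_zero, add_zero, EReal.coe_eq_coe_iff, Int.cast_inj] at h
        exact h.symm.trans (ih (by omega))
    have h0 : p 0 ≠ 0 := fun h0 => hg (eq_one_of_act_nilWord hnil h0)
    refine ⟨false, ?_⟩
    rw [hconst _ (pushIndex_lt _ _), hconst _ (pushIndex_lt _ _)]
    omega
  · have h := cocycle_pred_lt hk g hz0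
    rw [← hz, ← hp] at h
    rcases lt_or_ge (p (k - 1 - leadLength k x z.1)) 0 with h' | h'
    · exact ⟨!x, Or.inl (by rwa [pushIndex, Bool.not_not])⟩
    · exact ⟨x, Or.inr (by rw [pushIndex_pop_of_get? hk z.2 hz0]; omega)⟩

lemma exists_list_of_coordNorm (hk : 2 ≤ k) (n : ℕ) {g : DihedralArtin k} (hg : coordNorm g = n) :
    ∃ l : List (DihedralArtin k), (∀ s ∈ l, s ∈ artinGenerators k) ∧ l.length = n ∧ l.prod = g := by
  induction n generalizing g with
  | zero =>
    by_cases h1 : g = 1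
    · exact ⟨[], by simp, rfl, h1.symm⟩
    · obtain ⟨s, -, hs⟩ := exists_coordNorm_mul_eq hk h1
      have : 0 ≤ coordNorm (s * g) := Finset.sum_nonneg fun i _ => abs_nonneg _
      rw [hs, hg] at this
      simp at this
  | succ n ih =>
    have h1 : g ≠ 1 := by
      rintro rfl
      simp [coordNorm] at hg
      omega
    obtain ⟨s, hs, hsg⟩ := exists_coordNorm_mul_eq hk h1
    obtain ⟨l, hl, hlen, hprod⟩ := ih (g := s * g) (by rw [hsg, hg]; simp)
    refine ⟨s⁻¹ :: l, ?_, by simp [hlen], by simp [hprod]⟩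
    intro t ht
    rcases List.mem_cons.1 ht with rfl | ht
    exacts [inv_mem_artinGenerators k _ hs, hl t ht]

lemma wordLength_eq_coordNorm (hk : 2 ≤ k) (g : DihedralArtin k) :
    (wordLength (artinGenerators k) g : ℤ) = coordNorm g := by
  apply le_antisymm
  · obtain ⟨n, hn⟩ := Int.eq_ofNat_of_zero_le
      (show 0 ≤ coordNorm g from Finset.sum_nonneg fun i _ => abs_nonneg _)
    obtain ⟨l, hl, hlen, rfl⟩ := exists_list_of_coordNorm hk n hn
    rw [hn, ← hlen]
    exact_mod_cast wordLength_le _ l hl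
  · obtain ⟨l, hl, hlen, hprod⟩ :=
      exists_word_of_generates (inv_mem_artinGenerators k) (closure_artinGenerators k) g
    rw [← hlen]
    conv_lhs => rw [← hprod]
    exact coordNorm_list_prod_le hl

end DihedralArtin

namespace DihedralArtin

open Stream'

variable {k : ℕ}

/-! ### Decompositions into maximal alternating substrings -/

lemma altList_add (x : Bool) (l m : ℕ) :
    altList x (l + m) = altList x l ++ altList (altLetter x l) m := by
  simp [altList, List.range_add, altLetter_altLetter, Function.comp_def]

lemma occursAt_altList_iff {z : Seq Bool} {n : ℕ} {x : Bool} {l : ℕ} :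
    OccursAt z n (altList x l) ↔ StartsAlt (z.drop n) x l := by
  unfold OccursAt StartsAlt
  rw [length_altList]
  exact forall₂_congr fun j hj => by rw [Seq.drop_get?, getElem?_altList hj]

lemma wordProd_append (u v : List Bool) : wordProd k (u ++ v) = wordProd k u * wordProd k v := by
  simp [wordProd]

lemma startPos_succ (D : Seq (List Bool)) (n : ℕ) :
    startPos D (n + 1) = startPos D n + (D.get? n).elim 0 List.length :=
  Finset.sum_range_succ _ _

variable [NeZero k]

lemma IsDecomposition.exists_altList {z : Seq Bool} {D : Seq (List Bool)}
    (hD : IsDecomposition k z D) {n : ℕ} {u : List Bool} (hu : D.get? n = some u) :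
    ∃ x l, 1 ≤ l ∧ l < k ∧ u = altList x l ∧ StartsAlt (z.drop (startPos D n)) x l := by
  obtain ⟨x, l, hl, hlk, rfl⟩ := wordProd_mem_Mplus.1 (hD.mem n u hu)
  exact ⟨x, l, hl, hlk, rfl, occursAt_altList_iff.1 (hD.occursAt n _ hu)⟩

/-- If the next substring continued the alternation, the two together would be alternating but not
in M⁺, hence of length at least k, and `z` would contain a forbidden block. -/
lemma IsDecomposition.get?_ne {z : Seq Bool} (hz : AltFree k z) {D : Seq (List Bool)}
    (hD : IsDecomposition k z D) {n : ℕ} {x : Bool} {l : ℕ} (hl : 1 ≤ l)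
    (hu : D.get? n = some (altList x l)) :
    (z.drop (startPos D (n + 1))).get? 0 ≠ some (altLetter x l) := by
  have hs : startPos D (n + 1) = startPos D n + l := by rw [startPos_succ, hu]; simp
  rcases hv : D.get? (n + 1) with _ | v
  · rw [Seq.drop_get?, add_zero, hD.exhausts _ hv]
    simp
  · obtain ⟨y, m, hm, -, rfl, hy⟩ := hD.exists_altList hv
    rw [hy.get?_zero (by omega)]
    intro h
    obtain rfl : y = altLetter x l := Option.some.inj h
    have hnot := hD.not_mem n _ _ hu hv
    rw [← wordProd_append, ← altList_add] at hnot
    refine hnot (wordProd_mem_Mplus.2 ⟨x, l + m, by omega, ?_, rfl⟩)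
    by_contra! hk
    refine hz (startPos D n) x (StartsAlt.mono (fun j hj => ?_) hk)
    rcases lt_or_ge j l with hj' | hj'
    · exact occursAt_altList_iff.1 (hD.occursAt n _ hu) j hj'
    · have := hy (j - l) (by omega)
      rw [altLetter_altLetter, Nat.add_sub_cancel' hj', Seq.drop_get?, hs] at this
      rw [← this, Seq.drop_get?]
      congr 1
      omega

lemma IsDecomposition.runLength_drop (hk : 2 ≤ k) {z : Seq Bool} (hz : AltFree k z)
    {D : Seq (List Bool)} (hD : IsDecomposition k z D) (n : ℕ) :
    runLength k (z.drop (startPos D n)) = (D.get? n).elim 0 List.length := by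
  rcases hu : D.get? n with _ | u
  · rw [Option.elim_none, runLength_eq_zero_iff hk, ← Seq.get?_zero_eq_none, Seq.drop_get?,
      add_zero, hD.exhausts n hu]
  · obtain ⟨x, l, hl, hlk, rfl, hx⟩ := hD.exists_altList hu
    have h0 := hD.get?_ne hz hl hu
    have hs : startPos D (n + 1) = startPos D n + l := by rw [startPos_succ, hu]; simp
    rw [hs, Seq.drop_get?] at h0
    rw [hx.eq_prependAlt, runLength_prependAlt hk (by omega) (by omega)]
    · simp
    · rwa [Seq.drop_get?, Seq.drop_get?, ← add_assoc]

lemma IsDecomposition.iterate_dropRun (hk : 2 ≤ k) {z : Seq Bool} (hz : AltFree k z)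
    {D : Seq (List Bool)} (hD : IsDecomposition k z D) (n : ℕ) :
    (dropRun k)^[n] z = z.drop (startPos D n) := by
  induction n with
  | zero => simp [startPos]
  | succ n ih =>
    rw [Function.iterate_succ_apply', ih, dropRun, hD.runLength_drop hk hz, startPos_succ]
    exact Seq.ext fun m => by rw [Seq.drop_get?, Seq.drop_get?, Seq.drop_get?, add_assoc]

omit [NeZero k] in
lemma AltFree.iterate_dropRun {z : Seq Bool} (hz : AltFree k z) (n : ℕ) :
    AltFree k ((dropRun k)^[n] z) := by
  induction n with
  | zero => exact hz
  | succ n ih => rw [Function.iterate_succ_apply']; exact ih.drop _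

variable (k) in
/-- The sequence of the maximal alternating substrings. -/
noncomputable def runs (z : Seq Bool) : Seq (List Bool) :=
  ⟨fun n => (((dropRun k)^[n] z).get? 0).map fun x =>
    altList x (leadLength k x ((dropRun k)^[n] z)), fun {n} h => by
      have h' := Seq.get?_zero_eq_none.1 (Option.map_eq_none_iff.1 h)
      have : (dropRun k)^[n + 1] z = Seq.nil := by
        rw [Function.iterate_succ_apply', h', dropRun_nil]
      change Option.map _ (((dropRun k)^[n + 1] z).get? 0) = none
      simp [this]⟩

omit [NeZero k] in
lemma get?_runs (z : Seq Bool) (n : ℕ) :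
    (runs k z).get? n = (((dropRun k)^[n] z).get? 0).map fun x =>
      altList x (leadLength k x ((dropRun k)^[n] z)) := rfl

omit [NeZero k] in
lemma elim_get?_runs (hk : 2 ≤ k) (z : Seq Bool) (n : ℕ) :
    ((runs k z).get? n).elim 0 List.length = runLength k ((dropRun k)^[n] z) := by
  rw [get?_runs]
  rcases h : ((dropRun k)^[n] z).get? 0 with _ | x
  · rw [Seq.get?_zero_eq_none.1 h, runLength_nil hk]
    rfl
  · simp [runLength_of_get? hk h]

omit [NeZero k] in
lemma iterate_dropRun_eq_drop (hk : 2 ≤ k) (z : Seq Bool) (n : ℕ) :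
    (dropRun k)^[n] z = z.drop (startPos (runs k z) n) := by
  induction n with
  | zero => simp [startPos]
  | succ n ih =>
    rw [startPos_succ, elim_get?_runs hk, Function.iterate_succ_apply', dropRun]
    conv_lhs => arg 1; rw [ih]
    exact Seq.ext fun m => by rw [Seq.drop_get?, Seq.drop_get?, Seq.drop_get?, add_assoc]

lemma isDecomposition_runs (hk : 2 ≤ k) {z : Seq Bool} (hz : AltFree k z) :
    IsDecomposition k z (runs k z) where
  occursAt n u hu := by
    rw [get?_runs, Option.map_eq_some_iff] at hu
    obtain ⟨x, -, rfl⟩ := hu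
    rw [occursAt_altList_iff, ← iterate_dropRun_eq_drop hk]
    exact startsAlt_leadLength k x _
  exhausts n hn := by
    rw [get?_runs, Option.map_eq_none_iff, iterate_dropRun_eq_drop hk, Seq.drop_get?] at hn
    exact hn
  mem n u hu := by
    rw [get?_runs, Option.map_eq_some_iff] at hu
    obtain ⟨x, hx, rfl⟩ := hu
    have h1 := leadLength_le k x ((dropRun k)^[n] z)
    have h2 : leadLength k x ((dropRun k)^[n] z) ≠ 0 := fun h =>
      (leadLength_eq_zero_iff hk).1 h hx
    exact wordProd_mem_Mplus.2 ⟨x, _, by omega, by omega, rfl⟩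
  not_mem n u v hu hv hmem := by
    rw [get?_runs, Option.map_eq_some_iff] at hu hv
    obtain ⟨x, hx, rfl⟩ := hu
    obtain ⟨y, hy, rfl⟩ := hv
    have hx0 : leadLength k x ((dropRun k)^[n] z) ≠ 0 := fun h =>
      (leadLength_eq_zero_iff hk).1 h hx
    have hy0 : leadLength k y ((dropRun k)^[n + 1] z) ≠ 0 := fun h =>
      (leadLength_eq_zero_iff hk).1 h hy
    have hne := get?_drop_leadLength (hz.iterate_dropRun n) x
    rw [← runLength_of_get? hk hx] at hne hx0 hmem
    rw [← dropRun, ← Function.iterate_succ_apply' (f := dropRun k), hy] at hne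
    generalize runLength k ((dropRun k)^[n] z) = l at *
    generalize leadLength k y ((dropRun k)^[n + 1] z) = m at *
    rw [← wordProd_append, wordProd_mem_Mplus] at hmem
    obtain ⟨x', l', -, -, h⟩ := hmem
    have hlen : l + m = l' := by simpa using congrArg List.length h
    have h1 := congrArg (·[0]?) h
    have h2 := congrArg (·[l]?) h
    simp only [getElem?_altList (show 0 < l' by omega), getElem?_altList (show l < l' by omega)]
      at h1 h2
    rw [List.getElem?_append_left (by simp; omega), getElem?_altList (by omega), altLetter_zero,
      altLetter_zero, Option.some_inj] at h1
    rw [List.getElem?_append_right (by simp), length_altList, Nat.sub_self,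
      getElem?_altList (by omega), altLetter_zero, ← h1] at h2
    exact hne h2

lemma DeltaFreeWord.altFree (z : DeltaFreeWord k) : AltFree k z.1 := altFree_iff.1 z.2

/-- Every decomposition cuts at the same places as the greedy one, and the greedy one is a
decomposition. -/
lemma substringCount_eq (hk : 2 ≤ k) (z : DeltaFreeWord k) {i : ℕ} (hi : i ≠ 0) :
    substringCount k z i = runCount k z.1 i := by
  unfold substringCount runCount
  congr 1
  ext n
  constructor
  · rintro ⟨D, hD, u, hu, rfl⟩
    change runLength k _ = _
    rw [hD.iterate_dropRun hk z.altFree, hD.runLength_drop hk z.altFree, hu]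
    rfl
  · intro hn
    have h := elim_get?_runs hk z.1 n
    rw [show runLength k _ = i from hn] at h
    refine ⟨runs k z.1, isDecomposition_runs hk z.altFree, ?_⟩
    rcases hu : (runs k z.1).get? n with _ | u
    · rw [hu] at h
      exact absurd h.symm hi
    · exact ⟨u, rfl, by rwa [hu] at h⟩

end DihedralArtin

/-! ### Injectivity up to the identifications in Ω. -/

namespace DihedralArtin

open Stream'

variable {k : ℕ}

/-! ### Differences of absolute values -/

open scoped Classical in
/-- The difference `|P + c| - |P|`, extended continuously to `P = ±∞`. -/
noncomputable def absDiff (P : EReal) (c : ℤ) : ℝ :=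
  if P = ⊤ then c else if P = ⊥ then -c else |P.toReal + c| - |P.toReal|

@[simp] lemma absDiff_top (c : ℤ) : absDiff ⊤ c = c := if_pos rfl

@[simp] lemma absDiff_bot (c : ℤ) : absDiff ⊥ c = -c := by simp [absDiff]

@[simp] lemma absDiff_coe (r : ℝ) (c : ℤ) : absDiff r c = |r + c| - |r| := by simp [absDiff]

@[simp] lemma absDiff_zero (P : EReal) : absDiff P 0 = 0 := by
  induction P using EReal.rec <;> simp

lemma absDiff_add (P : EReal) (c d : ℤ) :
    absDiff P (c + d) = absDiff P c + absDiff (P + ((c : ℝ) : EReal)) d := by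
  induction P using EReal.rec with
  | bot => simp; ring
  | top => simp
  | coe r =>
    rw [← EReal.coe_add, absDiff_coe, absDiff_coe, absDiff_coe]
    push_cast
    rw [add_assoc]
    ring

lemma absDiff_succ_sub {P : EReal} (hP : P ∈ ExtInt) (n : ℤ) :
    absDiff P (n + 1) - absDiff P n = if ((-n : ℤ) : ℝ) ≤ P then 1 else -1 := by
  rcases hP with rfl | rfl | ⟨m, rfl⟩
  · simp
  · simp
  · rw [absDiff_coe, absDiff_coe]
    simp only [EReal.coe_le_coe_iff, Int.cast_le]
    push_cast
    split_ifs with h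
    · have h' : (0 : ℝ) ≤ m + n := by exact_mod_cast (by omega : 0 ≤ m + n)
      rw [abs_of_nonneg h', abs_of_nonneg (by linarith)]
      ring
    · have h' : (m : ℝ) + n + 1 ≤ 0 := by exact_mod_cast (by omega : m + n + 1 ≤ 0)
      rw [abs_of_nonpos (by linarith : (m : ℝ) + n ≤ 0), abs_of_nonpos (by linarith)]
      ring

lemma extInt_add_int {P : EReal} (hP : P ∈ ExtInt) (c : ℤ) : P + ((c : ℝ) : EReal) ∈ ExtInt := by
  rcases hP with rfl | rfl | ⟨m, rfl⟩
  · exact Or.inl (by simp)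
  · exact Or.inr (Or.inl (by simp))
  · exact Or.inr (Or.inr ⟨m + c, by push_cast; rfl⟩)

lemma extInt_eq_of_forall_le_iff {P Q : EReal} (hP : P ∈ ExtInt) (hQ : Q ∈ ExtInt)
    (h : ∀ n : ℤ, ((n : ℝ) : EReal) ≤ P ↔ ((n : ℝ) : EReal) ≤ Q) : P = Q := by
  rcases hP with rfl | rfl | ⟨m, rfl⟩ <;> rcases hQ with rfl | rfl | ⟨n, rfl⟩
  · rfl
  · simpa using h 0
  · simpa using h n
  · simpa using h 0
  · rfl
  · have := h (n + 1)
    simp only [le_top, true_iff, EReal.coe_le_coe_iff, Int.cast_le] at this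
    omega
  · simpa using h m
  · have := h (m + 1)
    simp only [le_top, iff_true, EReal.coe_le_coe_iff, Int.cast_le] at this
    omega
  · have h1 := h m
    have h2 := h n
    simp only [EReal.coe_le_coe_iff, Int.cast_le, le_refl, true_iff, iff_true] at h1 h2
    rw [le_antisymm h1 h2]

/-! ### Recovering a vector and a word from the associated function -/

lemma Admissible.le_succ {p : ℕ → EReal} {z : Seq Bool} (h : Admissible k (· ≤ ·) p z) {i : ℕ}
    (hi : i + 1 < k) : p i ≤ p (i + 1) :=
  le_trans (le_add_of_nonneg_right (EReal.coe_ennreal_nonneg _)) (h i hi)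

lemma Admissible.le {p : ℕ → EReal} {z : Seq Bool} (h : Admissible k (· ≤ ·) p z) {i j : ℕ}
    (hij : i ≤ j) (hj : j < k) : p i ≤ p j := by
  induction j, hij using Nat.le_induction with
  | base => exact le_rfl
  | succ j _ ih => exact (ih (by omega)).trans (h.le_succ hj)

/-- Successive differences of the sums count the coordinates that are at least t. By monotonicity
these coordinates form a final segment of the index set, and final segments of equal size coincide.
-/
lemma eq_of_sum_absDiff_eq {p p' : ℕ → EReal} (hp : ∀ i, p i ∈ ExtInt) (hp' : ∀ i, p' i ∈ ExtInt)
    (hmono : ∀ i j, i ≤ j → j < k → p i ≤ p j) (hmono' : ∀ i j, i ≤ j → j < k → p' i ≤ p' j)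
    (h : ∀ n : ℤ, ∑ i ∈ Finset.range k, absDiff (p i) n = ∑ i ∈ Finset.range k, absDiff (p' i) n)
    {i : ℕ} (hi : i < k) : p i = p' i := by
  classical
  refine extInt_eq_of_forall_le_iff (hp i) (hp' i) fun t => ?_
  have hsum : ∀ q : ℕ → EReal, (∀ i, q i ∈ ExtInt) →
      ∑ i ∈ Finset.range k, absDiff (q i) (-t + 1) - ∑ i ∈ Finset.range k, absDiff (q i) (-t) =
        2 * ((Finset.range k).filter fun i => ((t : ℝ) : EReal) ≤ q i).card - k := by
    intro q hq
    rw [← Finset.sum_sub_distrib, Finset.sum_congr rfl fun i _ => absDiff_succ_sub (hq i) (-t)]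
    have : ∀ i, (if ((- -t : ℤ) : ℝ) ≤ q i then (1 : ℝ) else -1) =
        2 * (if ((t : ℝ) : EReal) ≤ q i then 1 else 0) - 1 := fun i => by
      rw [neg_neg]
      split_ifs <;> norm_num
    simp only [this, Finset.sum_sub_distrib, ← Finset.mul_sum, Finset.sum_boole]
    simp
  have hcard : ((Finset.range k).filter fun i => ((t : ℝ) : EReal) ≤ p i).card =
      ((Finset.range k).filter fun i => ((t : ℝ) : EReal) ≤ p' i).card := by
    have h1 := hsum p hp
    rw [h, h, hsum p' hp'] at h1
    have : (((Finset.range k).filter fun i => ((t : ℝ) : EReal) ≤ p i).card : ℝ) =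
      ((Finset.range k).filter fun i => ((t : ℝ) : EReal) ≤ p' i).card := by linarith
    exact_mod_cast this
  have hset : ((Finset.range k).filter fun i => ((t : ℝ) : EReal) ≤ p i) =
      ((Finset.range k).filter fun i => ((t : ℝ) : EReal) ≤ p' i) := by
    by_cases hsub : ((Finset.range k).filter fun i => ((t : ℝ) : EReal) ≤ p i) ⊆
      ((Finset.range k).filter fun i => ((t : ℝ) : EReal) ≤ p' i)
    · exact Finset.eq_of_subset_of_card_le hsub hcard.ge
    · obtain ⟨a, ha, ha'⟩ := Finset.not_subset.1 hsub
      simp only [Finset.mem_filter, Finset.mem_range, not_and, not_le] at ha ha'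
      refine (Finset.eq_of_subset_of_card_le (fun b hb => ?_) hcard.le).symm
      simp only [Finset.mem_filter, Finset.mem_range] at hb ⊢
      refine ⟨hb.1, ha.2.trans (hmono a b ?_ hb.1)⟩
      by_contra! hba
      exact (ha' ha.1).not_ge (hb.2.trans (hmono' b a hba.le ha.1))
  have := Finset.ext_iff.1 hset i
  simpa [hi] using this

section

variable [NeZero k]

/-- The pairs `(p, z)` and `(p', z')` define the same function on the group. -/
def SameHoro (p : ℕ → EReal) (z : Word k) (p' : ℕ → EReal) (z' : Word k) : Prop :=
  ∀ g : DihedralArtin k, ∑ i ∈ Finset.range k, absDiff (p i) (cocycle g z i) =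
    ∑ i ∈ Finset.range k, absDiff (p' i) (cocycle g z' i)

variable {p p' : ℕ → EReal} {z z' : Word k}

lemma SameHoro.symm (h : SameHoro p z p' z') : SameHoro p' z' p z := fun g => (h g).symm

lemma SameHoro.act (h : SameHoro p z p' z') (g : DihedralArtin k) :
    SameHoro (shift p (cocycle g z)) (act g z) (shift p' (cocycle g z')) (act g z') := by
  intro f
  have h1 := h (f * g)
  simp only [cocycle_mul, Pi.add_apply, absDiff_add, Finset.sum_add_distrib] at h1
  rw [h g] at h1
  exact add_left_cancel h1

/-- On Δ^n the cocycle is n in every coordinate, at every word, so these values involve the vectors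
only. -/
lemma SameHoro.eq (h : SameHoro p z p' z') (hp : ∀ i, p i ∈ ExtInt) (hp' : ∀ i, p' i ∈ ExtInt)
    (hz : Admissible k (· ≤ ·) p z.1) (hz' : Admissible k (· ≤ ·) p' z'.1) {i : ℕ} (hi : i < k) :
    p i = p' i := by
  refine eq_of_sum_absDiff_eq hp hp' (fun _ _ => hz.le) (fun _ _ => hz'.le) (fun n => ?_) hi
  have := h (garside k ^ n)
  rwa [Finset.sum_congr rfl fun i hi =>
      congrArg (absDiff (p i)) (cocycle_garside_zpow n z (Finset.mem_range.1 hi)),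
    Finset.sum_congr rfl fun i hi =>
      congrArg (absDiff (p' i)) (cocycle_garside_zpow n z' (Finset.mem_range.1 hi))] at this

lemma act_altProd {x : Bool} {l : ℕ} (hl : l ≤ k - 1) (z : Word k)
    (hx : z.1.get? 0 ≠ some (altLetter x l)) :
    (act (altProd (gen k) x l) z).1 = prependAlt x l z.1 := by
  rw [DihedralArtin.act, stateHom_altProd, altProd_genState hl x 0 z hx]

/-- Prepend t alternating letters that lead up to x: the leading substring of `z` extends to length
t + l, while for `z'` it has length exactly t. A suitable t puts k - q above t and not above t + l.
-/
lemma exists_pushIndex_lt_of_get?_zero (hk : 2 ≤ k) {q : ℕ} (hq : 1 ≤ q) (hqk : q < k)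
    {x : Bool} (hz : z.1.get? 0 = some x) (hz' : z'.1.get? 0 ≠ some x) :
    ∃ g y, pushIndex k y (DihedralArtin.act g z).1 < q ∧
      q ≤ pushIndex k y (DihedralArtin.act g z').1 := by
  obtain ⟨l, hl0, hlk, z₀, h0, h1⟩ : ∃ l, l ≠ 0 ∧ l ≤ k - 1 ∧ ∃ z₀ : Word k,
      z₀.1.get? 0 ≠ some (altLetter x l) ∧
        DihedralArtin.act (altProd (gen k) x l) z₀ = z := by
    refine ⟨leadLength k x z.1, fun h => (leadLength_eq_zero_iff hk).1 h hz, leadLength_le k x z.1,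
      ⟨z.1.drop _, z.2.drop _⟩, get?_drop_leadLength z.2 x, Subtype.ext ?_⟩
    rw [act_altProd (leadLength_le k x z.1) _ (get?_drop_leadLength z.2 x)]
    exact (eq_prependAlt_leadLength k x z.1).symm
  -- The subtraction is truncated: if l ≥ k - q already, nothing is prepended.
  obtain ⟨t, ht⟩ : ∃ t, t = k - l - q := ⟨_, rfl⟩
  obtain ⟨w, hw⟩ : ∃ w, w = altLetter x t := ⟨_, rfl⟩
  have hwx : altLetter w t = x := by rw [hw, altLetter_self]
  have h0' : z₀.1.get? 0 ≠ some (altLetter w (t + l)) := by rwa [← altLetter_altLetter, hwx]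
  have h2 : (DihedralArtin.act (altProd (gen k) w t) z).1 = prependAlt w (t + l) z₀.1 := by
    rw [← act_altProd (by omega) _ h0', altProd_add, act_mul, hwx, h1]
  refine ⟨altProd (gen k) w t, !w, ?_, ?_⟩
  · rw [pushIndex, Bool.not_not, h2, leadLength_prependAlt (by omega) h0']
    omega
  · rw [← hwx] at hz'
    rw [pushIndex, Bool.not_not, act_altProd (by omega) _ hz', leadLength_prependAlt (by omega) hz']
    omega

/-- Popping the common letters reduces to words that differ in their first letter. -/
lemma exists_pushIndex_lt (hk : 2 ≤ k) {q : ℕ} (hq : 1 ≤ q) (hqk : q < k) (hzz : z ≠ z') :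
    ∃ g y, (pushIndex k y (DihedralArtin.act g z).1 < q ∧
        q ≤ pushIndex k y (DihedralArtin.act g z').1) ∨
      (pushIndex k y (DihedralArtin.act g z').1 < q ∧
        q ≤ pushIndex k y (DihedralArtin.act g z).1) := by
  obtain ⟨n, hn⟩ : ∃ n, z.1.get? n ≠ z'.1.get? n := by
    by_contra! h
    exact hzz (Subtype.ext (Seq.ext h))
  clear hzz
  induction n generalizing z z' with
  | zero =>
    rcases h : z.1.get? 0 with _ | x
    · rcases h' : z'.1.get? 0 with _ | x'
      · exact absurd (h.trans h'.symm) hn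
      · obtain ⟨g, y, hg⟩ := exists_pushIndex_lt_of_get?_zero (z' := z) hk hq hqk h' (by simp [h])
        exact ⟨g, y, Or.inr hg⟩
    · obtain ⟨g, y, hg⟩ := exists_pushIndex_lt_of_get?_zero hk hq hqk h
        (fun h' => hn (h.trans h'.symm))
      exact ⟨g, y, Or.inl hg⟩
  | succ n ih =>
    by_cases h0 : z.1.get? 0 = z'.1.get? 0
    · rcases h : z.1.get? 0 with _ | x
      · rw [Seq.get?_zero_eq_none.1 h, Seq.get?_zero_eq_none.1 (h0.symm.trans h)] at hn
        exact absurd rfl hn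
      · have e : ∀ z : Word k, z.1.get? 0 = some x →
            (DihedralArtin.act (gen k x)⁻¹ z).1 = z.1.tail := fun z hz => by
          rw [act_inv_gen]
          exact pop_of_eq hz
        obtain ⟨g, y, hg⟩ := ih (z := DihedralArtin.act (gen k x)⁻¹ z)
          (z' := DihedralArtin.act (gen k x)⁻¹ z')
          (by rwa [e z h, e z' (h0.symm.trans h), Seq.get?_tail, Seq.get?_tail])
        exact ⟨g * (gen k x)⁻¹, y, by rwa [act_mul, act_mul]⟩
    · rcases h : z.1.get? 0 with _ | x
      · rcases h' : z'.1.get? 0 with _ | x'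
        · exact absurd (h.trans h'.symm) h0
        · obtain ⟨g, y, hg⟩ := exists_pushIndex_lt_of_get?_zero (z' := z) hk hq hqk h' (by simp [h])
          exact ⟨g, y, Or.inr hg⟩
      · obtain ⟨g, y, hg⟩ := exists_pushIndex_lt_of_get?_zero hk hq hqk h
          (fun h' => h0 (h.trans h'.symm))
        exact ⟨g, y, Or.inl hg⟩

lemma SameHoro.not_lt (hk : 2 ≤ k) (h : SameHoro p z p' z') (hp : ∀ i, p i ∈ ExtInt)
    (hp' : ∀ i, p' i ∈ ExtInt) (hz : Admissible k (· ≤ ·) p z.1)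
    (hz' : Admissible k (· ≤ ·) p' z'.1) {q : ℕ} (hqk : q + 1 < k)
    (htop : ¬ (p q = ⊤ ∧ p (q + 1) = ⊤)) (hbot : ¬ (p q = ⊥ ∧ p (q + 1) = ⊥))
    (g : DihedralArtin k) (x : Bool) (hlt : pushIndex k x (DihedralArtin.act g z).1 < q + 1)
    (hge : q + 1 ≤ pushIndex k x (DihedralArtin.act g z').1) : False := by
  have hj' := pushIndex_lt (k := k) x (DihedralArtin.act g z').1
  have h1 := h.act g
  have hP1 := (admissible_act_iff hk isShiftInvariant_le g p z).2 hz
  have hP1' := (admissible_act_iff hk isShiftInvariant_le g p' z').2 hz'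
  have hqP : ∀ (c : EReal), c = ⊤ ∨ c = ⊥ → ∀ i, shift p (cocycle g z) i = c → p i = c := by
    rintro c hc i hi
    unfold shift at hi
    rcases hp i with h | h | ⟨m, h⟩
    · simpa [h] using hi
    · simpa [h] using hi
    · rw [h, ← EReal.coe_add] at hi
      rcases hc with rfl | rfl
      · exact absurd hi (EReal.coe_ne_top _)
      · exact absurd hi (EReal.coe_ne_bot _)
  have hE : ∀ i, shift p (cocycle g z) i ∈ ExtInt := fun i => extInt_add_int (hp i) _
  have hE' : ∀ i, shift p' (cocycle g z') i ∈ ExtInt := fun i => extInt_add_int (hp' i) _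
  generalize shift p (cocycle g z) = P at *
  generalize shift p' (cocycle g z') = P' at *
  generalize DihedralArtin.act g z = y at *
  generalize DihedralArtin.act g z' = y' at *
  have hPP : ∀ i < k, P i = P' i := fun i hi => h1.eq hE hE' hP1 hP1' hi
  have hQQ : ∀ i < k, shift P (cocycle (gen k x) y) i = shift P' (cocycle (gen k x) y') i :=
    fun i hi => (h1.act (gen k x)).eq (fun i => extInt_add_int (hE i) _)
      (fun i => extInt_add_int (hE' i) _) ((admissible_act_iff hk isShiftInvariant_le _ _ _).2 hP1)
      ((admissible_act_iff hk isShiftInvariant_le _ _ _).2 hP1') hi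
  have hs := h1 (gen k x)
  simp only [cocycle_gen] at hQQ hs
  generalize pushIndex k x y.1 = j at *
  generalize pushIndex k x y'.1 = j' at *
  have hsum : ∀ (q : ℕ → EReal) {m : ℕ}, m < k →
      ∑ i ∈ Finset.range k, absDiff (q i) ((Pi.single m 1 : ℕ → ℤ) i) = absDiff (q m) 1 := by
    intro q m hm
    rw [Finset.sum_eq_single_of_mem m (Finset.mem_range.2 hm)]
    · simp
    · intro i _ hi
      simp [Pi.single_eq_of_ne hi]
  rw [hsum P (by omega), hsum P' hj', ← hPP j' hj'] at hs
  have hinf : ∀ m, (P m + ((1 : ℤ) : ℝ) = P m) → P m = ⊤ ∨ P m = ⊥ := by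
    intro m hm
    rcases hE m with h | h | ⟨n, h⟩
    · exact Or.inr h
    · exact Or.inl h
    · rw [h, ← EReal.coe_add, EReal.coe_eq_coe_iff] at hm
      push_cast at hm
      linarith
  -- Coordinate `j` rises for the first pair only, yet the vectors agree before and after, so P_j +
  -- 1 = P_j.
  have hj1 : P j = ⊤ ∨ P j = ⊥ := by
    refine hinf j ?_
    have := hQQ j (by omega)
    rw [shift, shift, Pi.single_eq_same, Pi.single_eq_of_ne (by omega), ← hPP j (by omega)] at this
    simpa using this
  have hj2 : P j' = ⊤ ∨ P j' = ⊥ := by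
    refine hinf j' ?_
    have := hQQ j' hj'
    rw [shift, shift, Pi.single_eq_same, Pi.single_eq_of_ne (by omega), ← hPP j' hj'] at this
    simpa using this.symm
  -- The function changes by +1 at ⊤ and by -1 at ⊥, so the signs agree.
  have heq : P j = P j' := by
    rcases hj1 with h1 | h1 <;> rcases hj2 with h2 | h2 <;> rw [h1, h2] at hs ⊢
    · norm_num at hs
    · norm_num at hs
  have hle1 := hP1.le (show j ≤ q by omega) (by omega)
  have hle2 := hP1.le (show q ≤ q + 1 by omega) hqk
  have hle3 := hP1.le hge hj'
  have e1 : P q = P j := le_antisymm (heq ▸ hle2.trans hle3) hle1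
  have e2 : P (q + 1) = P j := le_antisymm (heq ▸ hle3) (hle1.trans hle2)
  have f1 := hqP _ hj1 q e1
  have f2 := hqP _ hj1 (q + 1) e2
  rcases hj1 with h | h <;> rw [h] at f1 f2
  exacts [htop ⟨f1, f2⟩, hbot ⟨f1, f2⟩]

lemma SameHoro.word_eq_or (hk : 2 ≤ k) (h : SameHoro p z p' z') (hp : ∀ i, p i ∈ ExtInt)
    (hp' : ∀ i, p' i ∈ ExtInt) (hz : Admissible k (· ≤ ·) p z.1)
    (hz' : Admissible k (· ≤ ·) p' z'.1) :
    z = z' ∨ (∀ i < k, p i = ⊤) ∨ (∀ i < k, p i = ⊥) := by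
  by_cases hcut : ∀ q, q + 1 < k → (p q = ⊤ ∧ p (q + 1) = ⊤) ∨ (p q = ⊥ ∧ p (q + 1) = ⊥)
  · right
    have hconst : ∀ i < k, p i = p 0 := by
      intro i hi
      induction i with
      | zero => rfl
      | succ i ih =>
        rw [← ih (by omega)]
        rcases hcut i hi with h | h <;> rw [h.1, h.2]
    rcases hcut 0 (by omega) with h | h
    · exact Or.inl fun i hi => (hconst i hi).trans h.1
    · exact Or.inr fun i hi => (hconst i hi).trans h.1
  · push Not at hcut
    obtain ⟨q, hq, htop, hbot⟩ := hcut
    left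
    by_contra hne
    have hpp : ∀ i < k, p i = p' i := fun i hi => h.eq hp hp' hz hz' hi
    obtain ⟨g, x, ⟨h1, h2⟩ | ⟨h1, h2⟩⟩ := exists_pushIndex_lt hk (q := q + 1) (by omega) hq hne
    · exact h.not_lt hk hp hp' hz hz' hq (by tauto) (by tauto) g x h1 h2
    · refine h.symm.not_lt hk hp' hp hz' hz hq ?_ ?_ g x h1 h2 <;>
        rw [← hpp q (by omega), ← hpp (q + 1) hq] <;> tauto

end

end DihedralArtin

/-! ### Continuity in the word and compactness of Ω'. -/

namespace DihedralArtin

open Stream'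

variable {k : ℕ}

/-! ### Words that agree up to some position -/

/-- The first `N` letters of `z` and `z'` agree. -/
def Agree (N : ℕ) (z z' : Seq Bool) : Prop := ∀ n < N, z.get? n = z'.get? n

namespace Agree

variable {M N l : ℕ} {x : Bool} {z z' : Seq Bool}

lemma mono (h : Agree N z z') (hM : M ≤ N) : Agree M z z' := fun n hn => h n (by omega)

lemma symm (h : Agree N z z') : Agree N z' z := fun n hn => (h n hn).symm

lemma startsAlt (h : Agree N z z') (hl : l ≤ N) (hz : StartsAlt z x l) : StartsAlt z' x l :=
  fun j hj => (h j (by omega)).symm.trans (hz j hj)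

lemma leadLength_eq (h : Agree N z z') (hN : k ≤ N) : leadLength k x z = leadLength k x z' := by
  have h1 := leadLength_le k x z
  have h2 := leadLength_le k x z'
  exact le_antisymm
    (le_leadLength h1 (h.startsAlt (by omega) (startsAlt_leadLength k x z)))
    (le_leadLength h2 (h.symm.startsAlt (by omega) (startsAlt_leadLength k x z')))

lemma runLength_eq (h : Agree N z z') (hN : k ≤ N) : runLength k z = runLength k z' := by
  rw [runLength, runLength, h.leadLength_eq hN, h.leadLength_eq hN]

lemma drop (h : Agree N z z') (n : ℕ) (hM : n + M ≤ N) : Agree M (z.drop n) (z'.drop n) :=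
  fun j hj => by rw [Seq.drop_get?, Seq.drop_get?, h _ (by omega)]

lemma twist (h : Agree N z z') : Agree N (twist k z) (twist k z') :=
  fun j hj => by rw [get?_twist, get?_twist, h j hj]

lemma cons (h : Agree N z z') : Agree N (Seq.cons x z) (Seq.cons x z') := fun j hj => by
  cases j with
  | zero => simp
  | succ j => rw [Seq.get?_cons_succ, Seq.get?_cons_succ, h j (by omega)]

lemma prependAlt (h : Agree N z z') :
    Agree N (prependAlt x l z) (DihedralArtin.prependAlt x l z') := fun j hj => by
  rw [get?_prependAlt, get?_prependAlt, h (j - l) (by omega)]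

lemma push (h : Agree N z z') (hM : M + k ≤ N) : Agree M (push k x z) (push k x z') := by
  by_cases hx : leadLength k (!x) z = k - 1
  · rw [push_of_eq hx, push_of_eq ((h.leadLength_eq (by omega)).symm.trans hx)]
    exact (h.drop _ (by omega)).twist
  · rw [push_of_ne hx, push_of_ne fun h' => hx ((h.leadLength_eq (by omega)).trans h')]
    exact (h.mono (by omega)).cons

lemma pop (h : Agree N z z') (hM : M + 1 ≤ N) : Agree M (pop k x z) (pop k x z') := by
  by_cases hx : z.get? 0 = some x
  · rw [pop_of_eq hx, pop_of_eq ((h 0 (by omega)).symm.trans hx)]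
    exact h.drop 1 (by omega)
  · rw [pop_of_ne hx, pop_of_ne fun h' => hx ((h 0 (by omega)).trans h')]
    exact (h.mono (by omega)).twist.prependAlt

lemma dropRun (h : Agree N z z') (hM : M + 2 * k ≤ N) : Agree M (dropRun k z) (dropRun k z') := by
  have h1 := leadLength_le k false z
  have h2 := leadLength_le k true z
  rw [DihedralArtin.dropRun, DihedralArtin.dropRun, ← h.runLength_eq (by omega)]
  exact h.drop _ (by unfold runLength; omega)

lemma iterate_dropRun {n : ℕ} (h : Agree N z z') (hM : M + n * (2 * k) ≤ N) :
    Agree M ((DihedralArtin.dropRun k)^[n] z) ((DihedralArtin.dropRun k)^[n] z') := by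
  induction n generalizing M with
  | zero => exact h.mono (by simpa using hM)
  | succ n ih =>
    rw [Function.iterate_succ_apply', Function.iterate_succ_apply']
    refine (ih (M := M + 2 * k) ?_).dropRun le_rfl
    rw [Nat.add_one_mul] at hM
    omega

lemma eq_of_terminatedAt (h : Agree N z z') (hl : l < N) (hz : z'.get? l = none) : z = z' := by
  refine Seq.ext fun n => ?_
  rcases lt_or_ge n N with hn | hn
  · exact h n hn
  · rw [Seq.le_stable z (by omega) ((h l hl).trans hz), Seq.le_stable z' (by omega) hz]

end Agree

/-- Each generator inspects and removes boundedly many leading letters. This gives continuity of the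
action and local constancy of the cocycle in the word. -/
lemma exists_agree_act [NeZero k] (g : DihedralArtin k) (N : ℕ) :
    ∃ M, ∀ z z' : Word k, Agree M z.1 z'.1 →
      Agree N (act g z).1 (act g z').1 ∧ cocycle g z = cocycle g z' := by
  induction g using gen_induction generalizing N with
  | one => exact ⟨N, fun z z' h => by simpa using h⟩
  | gen_mul x g ih =>
    obtain ⟨M, hM⟩ := ih (N + k)
    refine ⟨M, fun z z' h => ?_⟩
    obtain ⟨h1, h2⟩ := hM z z' h
    rw [act_mul, act_mul, cocycle_mul, cocycle_mul, h2, act_gen, act_gen, cocycle_gen, cocycle_gen,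
      pushIndex, pushIndex, h1.leadLength_eq (by omega)]
    exact ⟨h1.push le_rfl, rfl⟩
  | inv_gen_mul x g ih =>
    obtain ⟨M, hM⟩ := ih (N + k + 1)
    refine ⟨M, fun z z' h => ?_⟩
    obtain ⟨h1, h2⟩ := hM z z' h
    have h3 : Agree (N + k) (pop k x (act g z).1) (pop k x (act g z').1) := h1.pop le_rfl
    rw [act_mul, act_mul, cocycle_mul, cocycle_mul, h2, act_inv_gen, act_inv_gen, cocycle_inv_gen,
      cocycle_inv_gen, pushIndex, pushIndex, h3.leadLength_eq (by omega)]
    exact ⟨h3.mono (by omega), rfl⟩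

/-! ### The topology on words -/

open Topology Filter

lemma isOpen_setOf_get? (n : ℕ) (o : Option Bool) :
    IsOpen {z : DeltaFreeWord k | z.1.get? n = o} := by
  have h : @Continuous _ _ _ ⊥ fun z : DeltaFreeWord k => z.1.get? n :=
    continuous_iInf_dom (i := n) continuous_induced_dom
  exact @IsOpen.preimage _ _ _ ⊥ _ h {o} trivial

lemma eventually_agree (z : DeltaFreeWord k) (N : ℕ) : ∀ᶠ z' in 𝓝 z, Agree N z'.1 z.1 :=
  (eventually_all_finite (Set.finite_lt_nat N)).2 fun n _ =>
    (isOpen_setOf_get? n (z.1.get? n)).mem_nhds rfl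

/-- Finite words are isolated: the absence of a letter after the last one is an open condition. -/
lemma nhds_eq_pure_of_terminates {z : DeltaFreeWord k} (hz : z.1.Terminates) :
    ∀ᶠ z' in 𝓝 z, z' = z := by
  obtain ⟨n, hn⟩ := hz
  filter_upwards [eventually_agree z (n + 1)] with z' hz'
  exact Subtype.ext (hz'.eq_of_terminatedAt (Nat.lt_succ_self n) hn)

/-- Lower semicontinuity of the counts: `c` substrings of length `i` are already visible in a finite
prefix. -/
lemma isOpen_setOf_le_runCount (c i : ℕ) :
    IsOpen {z : DeltaFreeWord k | (c : ℕ∞) ≤ runCount k z.1 i} := by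
  refine isOpen_iff_mem_nhds.2 fun z hz => ?_
  obtain ⟨t, ht, htc⟩ := Set.exists_subset_encard_eq (show (c : ℕ∞) ≤ runCount k z.1 i from hz)
  obtain ⟨B, hB⟩ := (Set.finite_of_encard_eq_coe htc).bddAbove
  filter_upwards [eventually_agree z (k + B * (2 * k))] with z' hz'
  rw [← htc]
  refine Set.encard_le_encard fun n hn => ?_
  have hle : n * (2 * k) ≤ B * (2 * k) := Nat.mul_le_mul_right _ (hB hn)
  change runLength k _ = i
  rw [(hz'.iterate_dropRun (M := k) (by omega)).runLength_eq le_rfl]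
  exact ht hn

instance : CompactSpace (DeltaFreeWord k) := by
  rcases Nat.eq_zero_or_pos k with rfl | hk
  -- For k = 0 the empty subword already has product Δ = 1.
  · have : IsEmpty (DeltaFreeWord 0) :=
      ⟨fun z => z.2 0 [] (fun j hj => by simp at hj) rfl⟩
    infer_instance
  have : NeZero k := ⟨by omega⟩
  let : TopologicalSpace (Option Bool) := ⊥
  have : DiscreteTopology (Option Bool) := ⟨rfl⟩
  let f : DeltaFreeWord k → ℕ → Option Bool := fun z n => z.1.get? n
  have hind : IsInducing f := ⟨by
    change (⨅ n : ℕ, _) = TopologicalSpace.induced f (⨅ n : ℕ, _)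
    rw [induced_iInf]
    simp only [induced_compose]
    rfl⟩
  have hinj : Function.Injective f := fun z z' h =>
    Subtype.ext (Seq.ext fun n => congrFun h n)
  have hopen : ∀ (n : ℕ) (s : Set (Option Bool)), IsOpen {g : ℕ → Option Bool | g n ∈ s} :=
    fun n s => (isOpen_discrete s).preimage (continuous_apply n)
  have hrange : Set.range f =
      (⋂ n : ℕ, {g | g n ∈ ({none}ᶜ : Set (Option Bool))} ∪ {g | g (n + 1) ∈ ({none} : Set _)}) ∩
      ⋂ (n : ℕ) (x : Bool),
        (⋂ j ∈ Set.Iio k, {g | g (n + j) ∈ ({some (altLetter x j)} : Set (Option Bool))})ᶜ := by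
    ext g
    simp only [Set.mem_range, Set.mem_inter_iff, Set.mem_iInter, Set.mem_union, Set.mem_ofPred_eq,
      Set.mem_compl_iff, Set.mem_singleton_iff, Set.mem_Iio]
    constructor
    · rintro ⟨z, rfl⟩
      refine ⟨fun n => or_iff_not_imp_left.2 fun h => z.1.2 (not_not.1 h), fun n x h => ?_⟩
      exact z.altFree n x fun j hj => by rw [Seq.drop_get?]; exact h j hj
    · rintro ⟨h1, h2⟩
      refine ⟨⟨⟨g, fun {n} hn => (h1 n).resolve_left (not_not.2 hn)⟩, altFree_iff.2 ?_⟩, rfl⟩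
      intro n x h
      refine h2 n x fun j hj => ?_
      exact (Seq.drop_get? (s := ⟨g, _⟩)).symm.trans (h j hj)
  have hclosed : IsClosed (Set.range f) := by
    rw [hrange]
    refine IsClosed.inter (isClosed_iInter fun n => IsClosed.union ?_ ?_)
      (isClosed_iInter fun n => isClosed_iInter fun x => IsOpen.isClosed_compl ?_)
    · exact (isClosed_discrete _).preimage (continuous_apply n)
    · exact (isClosed_discrete _).preimage (continuous_apply (n + 1))
    · exact (Set.finite_Iio k).isOpen_biInter fun j _ => hopen (n + j) _
  exact (IsClosedEmbedding.mk ⟨hind, hinj⟩ hclosed).compactSpace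

/-! ### The space `Ω'` -/

lemma isClosed_extInt : IsClosed ExtInt := by
  have h : ExtInt = ⋂ n : ℤ, (Set.Ioo ((n : ℝ) : EReal) (((n + 1 : ℤ) : ℝ) : EReal))ᶜ := by
    ext P
    simp only [Set.mem_iInter, Set.mem_compl_iff, Set.mem_Ioo, not_and, not_lt]
    constructor
    · rintro (rfl | rfl | ⟨m, rfl⟩) n hn
      · simp at hn
      · exact le_top
      · rw [EReal.coe_lt_coe_iff, Int.cast_lt] at hn
        rw [EReal.coe_le_coe_iff, Int.cast_le]
        omega
    · intro hP
      induction P using EReal.rec with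
      | bot => exact Or.inl rfl
      | top => exact Or.inr (Or.inl rfl)
      | coe r =>
        refine Or.inr (Or.inr ⟨⌊r⌋, ?_⟩)
        have h1 := hP ⌊r⌋
        rw [EReal.coe_lt_coe_iff, EReal.coe_le_coe_iff] at h1
        by_contra hne
        have h2 : (⌊r⌋ : ℝ) < r := lt_of_le_of_ne (Int.floor_le r) fun h => hne (by rw [h])
        have h3 := h1 h2
        push_cast at h3
        exact (Int.lt_floor_add_one r).not_ge h3
  rw [h]
  exact isClosed_iInter fun n => isOpen_Ioo.isClosed_compl

instance : CompactSpace ExtInt := isCompact_iff_compactSpace.1 isClosed_extInt.isCompact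

/-- A vector indexed by `Fin k`, extended by zero. -/
noncomputable def extend (p : Fin k → ExtInt) : ℕ → EReal :=
  fun i => if h : i < k then (p ⟨i, h⟩ : EReal) else 0

lemma extend_of_lt (p : Fin k → ExtInt) {i : ℕ} (hi : i < k) : extend p i = p ⟨i, hi⟩ := dif_pos hi

lemma extend_mem (p : Fin k → ExtInt) (i : ℕ) : extend p i ∈ ExtInt := by
  unfold extend
  split_ifs with h
  · exact (p ⟨i, h⟩).2
  · exact Or.inr (Or.inr ⟨0, by simp⟩)

lemma continuous_extend (i : ℕ) : Continuous fun p : Fin k → ExtInt => extend p i := by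
  unfold extend
  split_ifs with h
  · exact continuous_subtype_val.comp (continuous_apply _)
  · exact continuous_const

/-- In additive form the excluded cases hold automatically, since ⊥ + m = ⊥ and ⊤ + m = ⊤.
Finiteness of `m` under `T` matters when q' = ⊥: there ⊥ + ⊤ = ⊥, although q - ⊥ = ⊤ for every q ≠
⊥. -/
lemma le_sub_and_eq_iff {q q' : EReal} {m : ℕ∞} {T : Prop} (hT : T → m ≠ ⊤) :
    (¬ (q = ⊥ ∧ q' = ⊥) → ¬ (q = ⊤ ∧ q' = ⊤) →
        countCoe m ≤ q - q' ∧ (T → q - q' = countCoe m)) ↔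
      q' + countCoe m ≤ q ∧ (T → q' + countCoe m = q) := by
  rcases eq_or_ne m ⊤ with rfl | hm
  · have hT' : ¬ T := fun h => hT h rfl
    induction q using EReal.rec <;> induction q' using EReal.rec <;>
      simp [hT', countCoe, ← EReal.coe_sub]
  · lift m to ℕ using hm
    rw [countCoe_natCast]
    generalize (m : ℝ) = r
    induction q using EReal.rec with
    | coe a =>
      induction q' using EReal.rec with
      | coe b =>
        simp only [← EReal.coe_sub, ← EReal.coe_add, EReal.coe_le_coe_iff, EReal.coe_eq_coe_iff,
          EReal.coe_ne_bot, EReal.coe_ne_top, false_and, not_false_eq_true, true_implies]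
        rw [le_sub_iff_add_le', sub_eq_iff_eq_add', eq_comm (a := a)]
      | bot => simp
      | top => simp
    | bot => induction q' using EReal.rec <;> simp [← EReal.coe_add]
    | top => induction q' using EReal.rec <;> simp [← EReal.coe_add]

lemma mem_omegaPrime_iff (hk : 2 ≤ k) {w : (Fin k → ExtInt) × DeltaFreeWord k} :
    w ∈ OmegaPrime k ↔ Admissible k (· ≤ ·) (extend w.1) w.2.1 ∧
      (w.2.1.Terminates → Admissible k (· = ·) (extend w.1) w.2.1) := by
  have : NeZero k := ⟨by omega⟩
  have h : ∀ i (hi : i + 1 < k), _ := fun i (hi : i + 1 < k) =>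
    le_sub_and_eq_iff (q := w.1 ⟨i + 1, hi⟩) (q' := w.1 ⟨i, by omega⟩)
    (fun hT : w.2.1.Terminates => runCount_ne_top hk (i := k - (i + 1)) (by omega) hT)
  constructor
  · intro hw
    have h' : ∀ i (hi : i + 1 < k), _ := fun i (hi : i + 1 < k) => (h i hi).1 (by
      rw [← substringCount_eq hk _ (by omega)]
      exact hw (i + 1) (by omega) hi)
    refine ⟨fun i hi => ?_, fun hT i hi => ?_⟩
    · rw [extend_of_lt _ hi, extend_of_lt _ (by omega : i < k)]
      exact (h' i hi).1
    · rw [extend_of_lt _ hi, extend_of_lt _ (by omega : i < k)]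
      exact (h' i hi).2 hT
  · rintro ⟨h1, h2⟩ i hi hik
    obtain ⟨i, rfl⟩ := Nat.exists_eq_succ_of_ne_zero (by omega : i ≠ 0)
    have := (h i hik).2 (by
      rw [← extend_of_lt _ hik, ← extend_of_lt _ (by omega : i < k)]
      exact ⟨h1 i hik, fun hT => h2 hT i hik⟩)
    rw [← substringCount_eq hk _ (by omega)] at this
    exact this

/-- Replacing `m` by its finite lower bounds lets closedness follow from lower semicontinuity of the
counts. -/
lemma add_countCoe_le_iff {P Q : EReal} {m : ℕ∞} :
    P + countCoe m ≤ Q ↔ ∀ c : ℕ, c ≤ m → P + ((c : ℝ) : EReal) ≤ Q := by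
  have hmono : ∀ c : ℕ, c ≤ m → ((c : ℝ) : EReal) ≤ countCoe m := fun c hc => by
    rw [← countCoe_natCast]
    exact EReal.coe_ennreal_le_coe_ennreal_iff.2 (ENat.toENNReal_le.2 hc)
  refine ⟨fun h c hc => (add_le_add_right (hmono c hc) P).trans h, fun h => ?_⟩
  rcases eq_or_ne m ⊤ with rfl | hm
  · have hall : ∀ c : ℕ, P + ((c : ℝ) : EReal) ≤ Q := fun c => h c le_top
    induction P using EReal.rec with
    | bot => simp
    | top => simpa using hall 0
    | coe r =>
      suffices Q = ⊤ by simp [this]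
      rw [EReal.eq_top_iff_forall_lt]
      intro y
      obtain ⟨n, hn⟩ := exists_nat_gt (y - r)
      refine lt_of_lt_of_le ?_ (hall n)
      rw [← EReal.coe_add, EReal.coe_lt_coe_iff]
      linarith
  · lift m to ℕ using hm
    rw [countCoe_natCast]
    exact h m le_rfl

/-- The inequalities are closed by lower semicontinuity. The extra equalities concern only finite
words, which are isolated, so a strict inequality there persists nearby. -/
lemma isClosed_omegaPrime (hk : 2 ≤ k) : IsClosed (OmegaPrime k) := by
  have : NeZero k := ⟨by omega⟩
  have hcont : ∀ i, Continuous fun w : (Fin k → ExtInt) × DeltaFreeWord k => extend w.1 i :=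
    fun i => (continuous_extend i).comp continuous_fst
  have hcont' : ∀ i (c : ℕ), Continuous fun w : (Fin k → ExtInt) × DeltaFreeWord k =>
      extend w.1 i + ((c : ℝ) : EReal) := fun i c =>
    continuous_iff_continuousAt.2 fun w => Tendsto.comp (EReal.continuousAt_add
      (Or.inr (EReal.coe_ne_bot _)) (Or.inr (EReal.coe_ne_top _)))
      (((hcont i).tendsto w).prodMk_nhds tendsto_const_nhds)
  have hle : IsClosed {w : (Fin k → ExtInt) × DeltaFreeWord k |
      Admissible k (· ≤ ·) (extend w.1) w.2.1} := by
    simp only [Admissible, add_countCoe_le_iff, Set.ofPred_forall]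
    refine isClosed_iInter fun i => isClosed_iInter fun hi => isClosed_iInter fun c => ?_
    simp only [imp_iff_not_or]
    refine IsClosed.union ?_ (isClosed_le (hcont' i c) (hcont _))
    exact ((isOpen_setOf_le_runCount c _).preimage continuous_snd).isClosed_compl
  have heq : IsClosed {w : (Fin k → ExtInt) × DeltaFreeWord k |
      w.2.1.Terminates → ∀ i, i + 1 < k →
        extend w.1 (i + 1) ≤ extend w.1 i + countCoe (runCount k w.2.1 (k - (i + 1)))} := by
    refine ⟨isOpen_iff_mem_nhds.2 fun w hw => ?_⟩
    simp only [Set.mem_compl_iff, Set.mem_ofPred_eq, Classical.not_imp, not_forall, not_le] at hw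
    obtain ⟨hT, i, hi, hlt⟩ := hw
    have hc := runCount_ne_top hk (i := k - (i + 1)) (by omega) hT
    have h1 : ∀ᶠ w' in 𝓝 w, w'.2 = w.2 :=
      continuous_snd.continuousAt.eventually (nhds_eq_pure_of_terminates hT)
    obtain ⟨c, hc'⟩ := ENat.ne_top_iff_exists.1 hc
    rw [← hc', countCoe_natCast] at hlt
    have h2 : ∀ᶠ w' in 𝓝 w, extend w'.1 i + ((c : ℝ) : EReal) < extend w'.1 (i + 1) :=
      (isOpen_lt (hcont' i c) (hcont _)).mem_nhds hlt
    filter_upwards [h1, h2] with w' h1 h2 h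
    rw [← countCoe_natCast, hc', ← h1] at h2
    exact (h (h1 ▸ hT) i hi).not_gt h2
  convert hle.inter heq using 1
  ext w
  rw [mem_omegaPrime_iff hk]
  refine and_congr_right fun h1 => forall_congr' fun hT => forall₂_congr fun i hi => ?_
  exact ⟨fun h => h.ge, fun h => le_antisymm (h1 i hi) h⟩

lemma compactSpace_omegaPrime (hk : 2 ≤ k) : CompactSpace (OmegaPrime k) :=
  isCompact_iff_compactSpace.1 (isClosed_omegaPrime hk).isCompact

end DihedralArtin

namespace DihedralArtin

open Stream'

variable {k : ℕ}

open Topology Filter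

/-! ### The functions associated with the points of `Ω'` -/

/-- Once |P| > |c| the difference is ±c according to the sign of P, hence constant near ±∞. -/
lemma continuous_absDiff (c : ℤ) : Continuous fun P => absDiff P c := by
  refine continuous_iff_continuousAt.2 fun P => ?_
  induction P using EReal.rec with
  | bot =>
    have h : ∀ᶠ Q : EReal in 𝓝 ⊥, absDiff Q c = absDiff ⊥ c := by
      filter_upwards [Iio_mem_nhds (EReal.bot_lt_coe (-|(c : ℝ)|))] with Q hQ
      induction Q using EReal.rec with
      | bot => rfl
      | top => simp at hQ
      | coe r =>
        have hQ : r < -|(c : ℝ)| := EReal.coe_lt_coe_iff.1 hQ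
        have h1 := neg_abs_le (c : ℝ)
        have h2 := le_abs_self (c : ℝ)
        rw [absDiff_coe, absDiff_bot, abs_of_nonpos (by linarith), abs_of_nonpos (by linarith)]
        ring
    exact (continuousAt_congr h).2 continuousAt_const
  | top =>
    have h : ∀ᶠ Q : EReal in 𝓝 ⊤, absDiff Q c = absDiff ⊤ c := by
      filter_upwards [Ioi_mem_nhds (EReal.coe_lt_top |(c : ℝ)|)] with Q hQ
      induction Q using EReal.rec with
      | bot => simp at hQ
      | top => rfl
      | coe r =>
        have hQ : |(c : ℝ)| < r := EReal.coe_lt_coe_iff.1 hQ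
        have h1 := neg_abs_le (c : ℝ)
        have h2 := le_abs_self (c : ℝ)
        rw [absDiff_coe, absDiff_top, abs_of_nonneg (by linarith), abs_of_nonneg (by linarith)]
        ring
    exact (continuousAt_congr h).2 continuousAt_const
  | coe r =>
    have h : ∀ᶠ Q : EReal in 𝓝 (r : EReal), absDiff Q c = |Q.toReal + c| - |Q.toReal| := by
      filter_upwards [isOpen_ne.mem_nhds (EReal.coe_ne_top r),
        isOpen_ne.mem_nhds (EReal.coe_ne_bot r)] with Q h1 h2
      rw [absDiff, if_neg h1, if_neg h2]
    refine (continuousAt_congr h).2 ?_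
    have ht : ContinuousAt EReal.toReal (r : EReal) :=
      EReal.tendsto_toReal (EReal.coe_ne_top r) (EReal.coe_ne_bot r)
    exact (ht.add continuousAt_const).abs.sub ht.abs

instance : DiscreteTopology (DihedralArtin k) := by
  refine DiscreteTopology.of_forall_le_dist one_pos fun g h hne => ?_
  have h0 : dist g h ≠ 0 := dist_ne_zero.2 hne
  change (wordLength (artinGenerators k) (g⁻¹ * h) : ℝ) ≠ 0 at h0
  change 1 ≤ (wordLength (artinGenerators k) (g⁻¹ * h) : ℝ)
  exact_mod_cast Nat.one_le_iff_ne_zero.2 (by exact_mod_cast h0)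

variable [NeZero k]

/-- A word of `Z` as a word without alternating blocks of length `k`. -/
def DeltaFreeWord.toWord (z : DeltaFreeWord k) : Word k := ⟨z.1, z.altFree⟩

/-- A word without alternating blocks of length `k` as a word of `Z`. -/
def deltaFreeWord (z : Word k) : DeltaFreeWord k := ⟨z.1, altFree_iff.2 z.2⟩

/-- The function on the group associated with a pair of a vector and a word. -/
noncomputable def horoMap (w : (Fin k → ExtInt) × DeltaFreeWord k) : C(DihedralArtin k, ℝ) where
  toFun g := ∑ i ∈ Finset.range k, absDiff (extend w.1 i) (cocycle g⁻¹ w.2.toWord i)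
  continuous_toFun := continuous_of_discreteTopology

lemma horoMap_apply (w : (Fin k → ExtInt) × DeltaFreeWord k) (g : DihedralArtin k) :
    horoMap w g =
      ∑ i ∈ Finset.range k, absDiff (extend w.1 i) (cocycle g⁻¹ w.2.toWord i) := rfl

lemma continuous_horoMap : Continuous (horoMap (k := k)) := by
  refine ContinuousMap.continuous_of_continuous_uncurry _ ?_
  refine continuous_prod_of_discrete_right.2 fun g => continuous_iff_continuousAt.2 fun w => ?_
  obtain ⟨M, hM⟩ := exists_agree_act (k := k) g⁻¹ 0
  have h1 : ∀ᶠ w' in 𝓝 w, horoMap w' g =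
      ∑ i ∈ Finset.range k, absDiff (extend w'.1 i) (cocycle g⁻¹ w.2.toWord i) := by
    filter_upwards [continuous_snd.continuousAt.eventually (eventually_agree w.2 M)] with w' hw'
    rw [horoMap_apply, (hM w'.2.toWord w.2.toWord hw').2]
  refine (continuousAt_congr h1).2 (Continuous.continuousAt ?_)
  exact continuous_finsetSum _ fun i _ =>
    (continuous_absDiff _).comp ((continuous_extend i).comp continuous_fst)

/-- The pair of the vector and the word that correspond to an element of the group. -/
noncomputable def point (g : DihedralArtin k) : (Fin k → ExtInt) × DeltaFreeWord k :=
  (fun i => ⟨((cocycle g (nilWord k) i : ℝ) : EReal), Or.inr (Or.inr ⟨_, rfl⟩)⟩,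
    deltaFreeWord (act g (nilWord k)))

lemma extend_point (g : DihedralArtin k) {i : ℕ} (hi : i < k) :
    extend (point g).1 i = ((cocycle g (nilWord k) i : ℝ) : EReal) := extend_of_lt _ hi

lemma point_mem (hk : 2 ≤ k) (g : DihedralArtin k) : point g ∈ OmegaPrime k := by
  have h : Admissible k (· = ·) (extend (point g).1) (point g).2.1 := fun i hi => by
    rw [extend_point g hi, extend_point g (by omega)]
    exact cocycle_succ hk g hi
  exact (mem_omegaPrime_iff hk).2 ⟨fun i hi => (h i hi).le, fun _ => h⟩

/-- By the cocycle identity the vector of f⁻¹g is that of g plus the cocycle of f⁻¹ at the word of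
g; the length formula is then applied termwise. -/
lemma horoMap_point (hk : 2 ≤ k) (g : DihedralArtin k) :
    horoMap (point g) = horoEmbedding 1 g := by
  ext f
  change ∑ i ∈ Finset.range k, absDiff (extend (point g).1 i)
      (cocycle f⁻¹ (act g (nilWord k)) i) =
    (wordLength (artinGenerators k) (f⁻¹ * g) : ℝ) - (wordLength (artinGenerators k) (1⁻¹ * g) : ℝ)
  have h : ∀ g : DihedralArtin k, (wordLength (artinGenerators k) g : ℝ) = (coordNorm g : ℝ) :=
    fun g => by exact_mod_cast congrArg (Int.cast (R := ℝ)) (wordLength_eq_coordNorm hk g)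
  rw [h, h, inv_one, one_mul, coordNorm, coordNorm, Int.cast_sum, Int.cast_sum,
    ← Finset.sum_sub_distrib]
  refine Finset.sum_congr rfl fun i hi => ?_
  rw [extend_point g (Finset.mem_range.1 hi), absDiff_coe, cocycle_mul, Pi.add_apply]
  push_cast
  rfl

lemma horoMap_eq_of_omegaRel {v w : OmegaPrime k} (h : OmegaRel k v w) :
    horoMap v.1 = horoMap w.1 := by
  ext g
  have hsum := congrArg (Int.cast (R := ℝ)) (sum_cocycle_eq g⁻¹ v.1.2.toWord w.1.2.toWord)
  rw [Int.cast_sum, Int.cast_sum] at hsum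
  have h1 : ∀ (u : OmegaPrime k) (c : EReal), (∀ i, (u.1.1 i : EReal) = c) → horoMap u.1 g =
      ∑ i ∈ Finset.range k, absDiff c (cocycle g⁻¹ u.1.2.toWord i) := fun u c hc => by
    rw [horoMap_apply]
    exact Finset.sum_congr rfl fun i hi => by rw [extend_of_lt _ (Finset.mem_range.1 hi), hc]
  rcases h with h | h
  · rw [h1 v ⊤ fun i => (h i).1, h1 w ⊤ fun i => (h i).2]
    simpa using hsum
  · rw [h1 v ⊥ fun i => (h i).1, h1 w ⊥ fun i => (h i).2]
    simpa using hsum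

lemma eq_or_omegaRel_of_horoMap_eq (hk : 2 ≤ k) {v w : OmegaPrime k}
    (h : horoMap v.1 = horoMap w.1) : v = w ∨ OmegaRel k v w := by
  have hs : SameHoro (extend v.1.1) v.1.2.toWord (extend w.1.1) w.1.2.toWord := fun g => by
    have := DFunLike.congr_fun h g⁻¹
    simpa only [horoMap_apply, inv_inv] using this
  have hv := ((mem_omegaPrime_iff hk).1 v.2).1
  have hw := ((mem_omegaPrime_iff hk).1 w.2).1
  have hp : ∀ i, v.1.1 i = w.1.1 i := fun i => by
    have := hs.eq (extend_mem _) (extend_mem _) hv hw i.2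
    rwa [extend_of_lt _ i.2, extend_of_lt _ i.2, Subtype.coe_inj] at this
  have key : ∀ c : EReal, (∀ i < k, extend v.1.1 i = c) →
      ∀ i, (v.1.1 i : EReal) = c ∧ (w.1.1 i : EReal) = c := fun c hc i => by
    have := hc i i.2
    rw [extend_of_lt _ i.2] at this
    exact ⟨this, hp i ▸ this⟩
  rcases hs.word_eq_or hk (extend_mem _) (extend_mem _) hv hw with h1 | h1 | h1
  · exact Or.inl (Subtype.ext (Prod.ext (funext hp) 
      (Subtype.ext (congrArg (fun z : Word k => z.1) h1))))
  · exact Or.inr (Or.inl (key ⊤ h1))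
  · exact Or.inr (Or.inr (key ⊥ h1))

end DihedralArtin

/-! ### Density of the group in Ω', and the conclusion. -/

namespace DihedralArtin

open Stream'

variable {k : ℕ}

open Topology Filter

/-! ### Approximation of the points of `Ω'` by elements of the group -/

lemma exists_list_count (k : ℕ) (e : ℕ → ℕ) :
    ∃ L : List ℕ, (∀ l ∈ L, l ≠ 0 ∧ l ≤ k - 1) ∧ ∀ i, i ≠ 0 → i ≤ k - 1 → L.count i = e i := by
  classical
  refine ⟨(∑ l ∈ Finset.Icc 1 (k - 1), Multiset.replicate (e l) l).toList, fun l hl => ?_,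
    fun i hi hik => ?_⟩
  · rw [Multiset.mem_toList, Multiset.mem_sum] at hl
    obtain ⟨m, hm, hl⟩ := hl
    obtain rfl := Multiset.eq_of_mem_replicate hl
    rw [Finset.mem_Icc] at hm
    exact ⟨by omega, hm.2⟩
  · rw [← Multiset.coe_count, Multiset.coe_toList, Multiset.count_sum']
    simp only [Multiset.count_replicate]
    rw [Finset.sum_ite_eq' , if_pos (Finset.mem_Icc.2 ⟨by omega, hik⟩)]

variable [NeZero k]

/-- Each substring starts with the last letter of the preceding one, so none of them merge. -/
lemma exists_word_of_lengths (hk : 2 ≤ k) (x : Bool) (L : List ℕ)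
    (hL : ∀ l ∈ L, l ≠ 0 ∧ l ≤ k - 1) :
    ∃ u : Word k, u.1.Terminates ∧ u.1.get? 0 ≠ some (!x) ∧
      ∀ i ≠ 0, runCount k u.1 i = L.count i := by
  induction L generalizing x with
  | nil =>
    exact ⟨nilWord k, Seq.terminates_nil, by simp [nilWord],
      fun i hi => by simpa [nilWord] using runCount_nil hk hi⟩
  | cons l L ih =>
    obtain ⟨u, hu, hu0, hcount⟩ := ih (!altLetter x l) fun m hm => hL m (List.mem_cons_of_mem l hm)
    rw [Bool.not_not] at hu0
    obtain ⟨hl0, hl⟩ := hL l List.mem_cons_self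
    refine ⟨⟨prependAlt x l u.1, u.2.prependAlt hl hu0⟩, prependAlt_terminates hu, ?_,
      fun i hi => ?_⟩
    · rw [(startsAlt_prependAlt x l u.1).get?_zero hl0]
      simp
    · rw [runCount_prependAlt hk hi hl hu0, hcount i hi, List.count_cons, add_comm]
      by_cases h : l = i <;> simp [h]

/-- Keep the first n substrings of `z`, with counts `c`, and append substrings of prescribed
lengths. As `c` is fixed before `L`, the list can later be chosen to make up any deficit. -/
lemma exists_word_agree (hk : 2 ≤ k) (n : ℕ) (z : Word k) (hz : ¬ z.1.Terminates) :
    ∃ c : ℕ → ℕ, (∀ i, c i ≤ n ∧ (c i : ℕ∞) ≤ runCount k z.1 i) ∧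
      ∀ L : List ℕ, (∀ l ∈ L, l ≠ 0 ∧ l ≤ k - 1) → ∃ u : Word k, u.1.Terminates ∧
        Agree n u.1 z.1 ∧ (∀ x, z.1.get? 0 ≠ some x → u.1.get? 0 ≠ some x) ∧
        ∀ i ≠ 0, runCount k u.1 i = c i + L.count i := by
  induction n generalizing z with
  | zero =>
    refine ⟨fun _ => 0, fun i => by simp, fun L hL => ?_⟩
    obtain ⟨x, hx⟩ := Option.isSome_iff_exists.1 (Seq.not_terminates_iff.1 hz 0)
    obtain ⟨u, hu, hu0, hcount⟩ := exists_word_of_lengths hk x L hL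
    refine ⟨u, hu, fun _ h => by omega, fun y hy => ?_, fun i hi => by simpa using hcount i hi⟩
    rw [hx] at hy
    have : y = !x := Bool.eq_not.2 fun h => hy (by rw [h])
    rwa [this]
  | succ n ih =>
    obtain ⟨x, hx⟩ := Option.isSome_iff_exists.1 (Seq.not_terminates_iff.1 hz 0)
    obtain ⟨l, hl⟩ : ∃ l, l = leadLength k x z.1 := ⟨_, rfl⟩
    have hl0 : l ≠ 0 := fun h => (leadLength_eq_zero_iff hk).1 (hl.symm.trans h) hx
    have hlk : l ≤ k - 1 := hl ▸ leadLength_le k x z.1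
    have hrun : runLength k z.1 = l := (runLength_of_get? hk hx).trans hl.symm
    have hz₀ : z.1 = prependAlt x l (dropRun k z.1) := by
      rw [dropRun, hrun, hl]
      exact eq_prependAlt_leadLength k x z.1
    have h0 : (dropRun k z.1).get? 0 ≠ some (altLetter x l) := by
      rw [dropRun, hrun, hl]
      exact get?_drop_leadLength z.2 x
    obtain ⟨c, hc, hL⟩ := ih ⟨dropRun k z.1, z.2.drop _⟩
      fun h => hz (hz₀ ▸ prependAlt_terminates h)
    refine ⟨fun i => (if l = i then 1 else 0) + c i, fun i => ⟨?_, ?_⟩, fun L hL' => ?_⟩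
    · have := (hc i).1
      dsimp only
      split_ifs <;> omega
    · rw [runCount_eq_add, hrun]
      push_cast
      exact add_le_add_right (hc i).2 _
    · obtain ⟨u, hu, hagree, hu0, hcount⟩ := hL L hL'
      have hu0 := hu0 _ h0
      refine ⟨⟨prependAlt x l u.1, u.2.prependAlt hlk hu0⟩, prependAlt_terminates hu, ?_, ?_,
        fun i hi => ?_⟩
      · intro j hj
        rw [hz₀, get?_prependAlt, get?_prependAlt]
        split_ifs
        · rfl
        · exact hagree _ (by omega)
      · intro y hy
        rwa [(startsAlt_prependAlt x l u.1).get?_zero hl0, ← hx]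
      · rw [runCount_prependAlt hk hi hlk hu0, hcount i hi]
        push_cast
        rw [add_assoc]

lemma act_garside_zpow_nilWord (r : ℤ) : act (garside k ^ r) (nilWord k) = nilWord k := by
  have h : act (garside k) (nilWord k) = nilWord k := by
    simp only [act, stateHom_garside]
    exact Subtype.ext (Seq.ext fun n => by rw [get?_twist]; simp [nilWord])
  have h' : act (garside k)⁻¹ (nilWord k) = nilWord k := by
    conv_lhs => rw [← h]
    exact act_inv_act _ _
  induction r with
  | zero => simp
  | succ n ih => rw [zpow_add_one, act_mul, h, ih]
  | pred n ih => rw [zpow_sub_one, act_mul, h', ih]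

/-- A power of Δ on the right adjusts coordinate 0 without changing the word; the substring counts
then force the other coordinates. -/
lemma exists_cocycle_eq (hk : 2 ≤ k) {u : Word k} (hu : u.1.Terminates) (P : ℕ → ℤ)
    (hP : ∀ i, i + 1 < k → ((P i : ℝ) : EReal) + countCoe (runCount k u.1 (k - (i + 1))) =
      ((P (i + 1) : ℝ) : EReal)) :
    ∃ g, act g (nilWord k) = u ∧ ∀ i < k, cocycle g (nilWord k) i = P i := by
  obtain ⟨v, hv⟩ := exists_eq_ofList hu
  have hv' : act (wordProd k v) (nilWord k) = u := by
    rw [act_wordProd (hv ▸ u.2)]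
    exact Subtype.ext hv.symm
  obtain ⟨g, hg⟩ : ∃ g, g = wordProd k v *
      garside k ^ (P 0 - cocycle (wordProd k v) (nilWord k) 0) :=
    ⟨_, rfl⟩
  have hact : act g (nilWord k) = u := by rw [hg, act_mul, act_garside_zpow_nilWord, hv']
  refine ⟨g, hact, fun i hi => ?_⟩
  induction i with
  | zero =>
    rw [hg, cocycle_mul, act_garside_zpow_nilWord, Pi.add_apply, cocycle_garside_zpow _ _ hi]
    ring
  | succ i ih =>
    have h := cocycle_succ hk g hi
    rw [hact, ih (by omega), hP i hi] at h
    exact_mod_cast h.symm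

/-- The integer `a` approximates `P`, with precision `n` if `P` is infinite. -/
def Approx (n : ℕ) (P : EReal) (a : ℤ) : Prop :=
  (P = ⊤ → (n : ℤ) ≤ a) ∧ (P = ⊥ → a ≤ -n) ∧ ∀ m : ℤ, P = ((m : ℝ) : EReal) → a = m

lemma approx_top {n : ℕ} {a : ℤ} (h : (n : ℤ) ≤ a) : Approx n ⊤ a :=
  ⟨fun _ => h, fun h => absurd h (by simp), fun m hm => absurd hm.symm (EReal.coe_ne_top _)⟩

lemma approx_bot {n : ℕ} {a : ℤ} (h : a ≤ -n) : Approx n ⊥ a :=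
  ⟨fun h => absurd h (by simp), fun _ => h, fun m hm => absurd hm.symm (EReal.coe_ne_bot _)⟩

lemma approx_coe {n : ℕ} {a : ℤ} : Approx n ((a : ℝ) : EReal) a :=
  ⟨fun h => absurd h (EReal.coe_ne_top _), fun h => absurd h (EReal.coe_ne_bot _), fun m hm => by
    exact_mod_cast hm⟩

lemma exists_approx_of_terminates (hk : 2 ≤ k) (n : ℕ) {p : ℕ → EReal} {z : Word k}
    (hp : ∀ i, p i ∈ ExtInt) (hz : z.1.Terminates) (h : Admissible k (· = ·) p z.1) :
    ∃ g, act g (nilWord k) = z ∧ ∀ i < k, Approx n (p i) (cocycle g (nilWord k) i) := by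
  have hm : ∀ i, ∃ m : ℕ, i + 1 < k → runCount k z.1 (k - (i + 1)) = m := fun i => by
    by_cases hi : i + 1 < k
    · obtain ⟨m, hm⟩ := ENat.ne_top_iff_exists.1
        (runCount_ne_top hk (i := k - (i + 1)) (by omega) hz)
      exact ⟨m, fun _ => hm.symm⟩
    · exact ⟨0, fun h => absurd h hi⟩
  choose m hm using hm
  have hg : ∀ Q : ℤ, ∃ g, act g (nilWord k) = z ∧
      ∀ i < k, cocycle g (nilWord k) i = Q + ∑ j ∈ Finset.range i, (m j : ℤ) := fun Q => by
    refine exists_cocycle_eq hk hz (fun i => Q + ∑ j ∈ Finset.range i, (m j : ℤ)) fun i hi => ?_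
    rw [hm i hi, countCoe_natCast, ← EReal.coe_add, Finset.sum_range_succ]
    push_cast
    rw [add_assoc]
  have hpi : ∀ i < k, p i = p 0 + ((∑ j ∈ Finset.range i, (m j : ℝ) : ℝ) : EReal) := by
    intro i hi
    induction i with
    | zero => simp
    | succ i ih =>
      rw [← h i hi, hm i hi, ih (by omega), countCoe_natCast, add_assoc, ← EReal.coe_add,
        Finset.sum_range_succ]
  rcases hp 0 with h0 | h0 | ⟨Q, h0⟩
  -- The starting value is low enough to keep even the largest coordinate at most -n.
  · obtain ⟨g, hg, hc⟩ := hg (-n - ∑ j ∈ Finset.range k, (m j : ℤ))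
    refine ⟨g, hg, fun i hi => ?_⟩
    rw [hpi i hi, h0, EReal.bot_add, hc i hi]
    refine approx_bot ?_
    have : ∑ j ∈ Finset.range i, (m j : ℤ) ≤ ∑ j ∈ Finset.range k, (m j : ℤ) :=
      Finset.sum_le_sum_of_subset_of_nonneg (by simpa using hi.le) fun _ _ _ => by positivity
    omega
  · obtain ⟨g, hg, hc⟩ := hg n
    refine ⟨g, hg, fun i hi => ?_⟩
    rw [hpi i hi, h0, EReal.top_add_coe, hc i hi]
    refine approx_top ?_
    have : 0 ≤ ∑ j ∈ Finset.range i, (m j : ℤ) := Finset.sum_nonneg fun _ _ => by positivity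
    omega
  · obtain ⟨g, hg, hc⟩ := hg Q
    refine ⟨g, hg, fun i hi => ?_⟩
    have : p i = (((Q + ∑ j ∈ Finset.range i, (m j : ℤ) : ℤ) : ℝ) : EReal) := by
      rw [hpi i hi, h0]
      push_cast
      rfl
    rw [this, hc i hi]
    exact approx_coe

/-- Approximate `p` by an integer vector whose gaps leave room for the substrings of a long prefix
of `z`, then append further substrings after that prefix until the counts equal the gaps. -/
lemma exists_approx_of_not_terminates (hk : 2 ≤ k) (n : ℕ) {p : ℕ → EReal} {z : Word k}
    (hp : ∀ i, p i ∈ ExtInt) (hz : ¬ z.1.Terminates) (h : Admissible k (· ≤ ·) p z.1) :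
    ∃ g, Agree n (act g (nilWord k)).1 z.1 ∧
      ∀ i < k, Approx n (p i) (cocycle g (nilWord k) i) := by
  classical
  obtain ⟨c, hc, hL⟩ := exists_word_agree hk n z hz
  obtain ⟨B, hB⟩ : ∃ B : ℕ, ∀ i < k, ∀ m : ℤ, p i = ((m : ℝ) : EReal) → |m| ≤ B := by
    refine ⟨∑ i ∈ Finset.range k, ⌊(p i).toReal⌋.natAbs, fun i hi m hm => ?_⟩
    have := Finset.single_le_sum (f := fun i => ⌊(p i).toReal⌋.natAbs) (fun _ _ => Nat.zero_le _)
      (Finset.mem_range.2 hi)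
    rw [hm, EReal.toReal_coe, Int.floor_intCast] at this
    rw [Int.abs_eq_natAbs]
    exact_mod_cast this
  -- Infinite coordinates are placed beyond the bound B on the finite ones and spaced n apart, so a
  -- gap with an infinite end is at least n, which bounds `c`. Gaps between finite coordinates
  -- exceed `c` by admissibility, or equal it.
  let P : ℕ → ℤ := fun i =>
    if p i = ⊤ then B + (i + 1) * n else if p i = ⊥ then -(B + (k - i) * n) else ⌊(p i).toReal⌋
  have hPtop : ∀ i, p i = ⊤ → P i = B + (i + 1) * n := fun i hi => if_pos hi
  have hPbot : ∀ i, p i = ⊥ → P i = -(B + (k - i) * n) := fun i hi => by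
    simp [P, hi]
  have hPcoe : ∀ i (m : ℤ), p i = ((m : ℝ) : EReal) → P i = m := fun i m hi => by
    simp [P, hi]
  have happrox : ∀ i < k, Approx n (p i) (P i) := by
    intro i hi
    have h1 : (0 : ℤ) ≤ i * n := by positivity
    have h2 : (0 : ℤ) ≤ (k - i - 1) * n := mul_nonneg (by omega) (by positivity)
    rcases hp i with h | h | ⟨m, h⟩
    · rw [h, hPbot i h]
      exact approx_bot (by linarith)
    · rw [h, hPtop i h]
      exact approx_top (by linarith)
    · rw [h, hPcoe i m h]
      exact approx_coe
  have hgap : ∀ i, i + 1 < k → P i + c (k - (i + 1)) ≤ P (i + 1) := by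
    intro i hi
    have hcn : (c (k - (i + 1)) : ℤ) ≤ n := by exact_mod_cast (hc _).1
    have h1 : (0 : ℤ) ≤ i * n := by positivity
    have h2 : (0 : ℤ) ≤ (k - i - 1) * n := mul_nonneg (by omega) (by positivity)
    have hle := h.le_succ hi
    rcases hp i with h3 | h3 | ⟨m, h3⟩ <;> rcases hp (i + 1) with h4 | h4 | ⟨m', h4⟩
    · rw [hPbot _ h3, hPbot _ h4]
      push_cast
      linarith
    · rw [hPbot _ h3, hPtop _ h4]
      push_cast
      linarith
    · have := neg_le_of_abs_le (hB _ hi m' h4)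
      rw [hPbot _ h3, hPcoe _ _ h4]
      linarith
    · simp [h3, h4] at hle
    · rw [hPtop _ h3, hPtop _ h4]
      push_cast
      linarith
    · rw [h3, h4] at hle
      exact absurd (top_le_iff.1 hle) (EReal.coe_ne_top _)
    · rw [h3, h4] at hle
      exact absurd (le_bot_iff.1 hle) (EReal.coe_ne_bot _)
    · have := le_of_abs_le (hB _ (by omega) m h3)
      rw [hPcoe _ _ h3, hPtop _ h4]
      push_cast
      linarith
    · have := add_countCoe_le_iff.1 (h i hi) _ (hc _).2
      rw [h3, h4, ← EReal.coe_add, EReal.coe_le_coe_iff] at this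
      rw [hPcoe _ _ h3, hPcoe _ _ h4]
      exact_mod_cast this
  -- Substrings of length l account for the gap between coordinates k - l - 1 and k - l; `hgap`
  -- ensures that `toNat` truncates nothing in the relevant range.
  obtain ⟨L, hLmem, hLcount⟩ := exists_list_count k fun l =>
    (P (k - l) - P (k - (l + 1)) - c l).toNat
  obtain ⟨u, hu, hagree, -, hcount⟩ := hL L hLmem
  obtain ⟨g, hg, hgc⟩ := exists_cocycle_eq hk hu P fun i hi => by
    have h1 := hgap i hi
    rw [hcount _ (by omega), hLcount _ (by omega) (by omega), ← Nat.cast_add, countCoe_natCast,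
      ← EReal.coe_add, show k - (k - (i + 1)) = i + 1 by omega,
      show k - (k - (i + 1) + 1) = i by omega]
    congr 2
    have h2 : ((c (k - (i + 1)) + (P (i + 1) - P i - c (k - (i + 1))).toNat : ℕ) : ℤ) =
        P (i + 1) - P i := by
      rw [Nat.cast_add, Int.toNat_of_nonneg (by omega)]
      ring
    have h3 : ((c (k - (i + 1)) + (P (i + 1) - P i - c (k - (i + 1))).toNat : ℕ) : ℝ) =
        P (i + 1) - P i := by exact_mod_cast congrArg (Int.cast (R := ℝ)) h2
    rw [h3]
    ring
  exact ⟨g, hg ▸ hagree, fun i hi => hgc i hi ▸ happrox i hi⟩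

lemma exists_approx (hk : 2 ≤ k) (w : OmegaPrime k) (n : ℕ) :
    ∃ g, Agree n (point g).2.1 w.1.2.1 ∧
      ∀ i : Fin k, Approx n (w.1.1 i) (cocycle g (nilWord k) i) := by
  obtain ⟨h1, h2⟩ := (mem_omegaPrime_iff hk).1 w.2
  have key : ∃ g, Agree n (act g (nilWord k)).1 w.1.2.toWord.1 ∧
      ∀ i < k, Approx n (extend w.1.1 i) (cocycle g (nilWord k) i) := by
    by_cases hz : w.1.2.1.Terminates
    · obtain ⟨g, hg, hc⟩ := exists_approx_of_terminates hk n (z := w.1.2.toWord)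
        (extend_mem w.1.1) hz (h2 hz)
      exact ⟨g, hg ▸ fun _ _ => rfl, hc⟩
    · exact exists_approx_of_not_terminates hk n (extend_mem w.1.1) hz h1
  obtain ⟨g, hg, hc⟩ := key
  exact ⟨g, hg, fun i => by simpa only [extend_of_lt _ i.2] using hc i i.2⟩

lemma tendsto_of_approx {P : EReal} (hP : P ∈ ExtInt) {a : ℕ → ℤ} (h : ∀ n, Approx n P (a n)) :
    Tendsto (fun n => ((a n : ℝ) : EReal)) atTop (𝓝 P) := by
  rcases hP with rfl | rfl | ⟨m, rfl⟩
  · refine EReal.tendsto_nhds_bot_iff_real.2 fun x => ?_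
    obtain ⟨N, hN⟩ := exists_nat_gt (-x)
    filter_upwards [eventually_ge_atTop N] with n hn
    have h1 : (a n : ℝ) ≤ -n := by exact_mod_cast (h n).2.1 rfl
    have h2 : (N : ℝ) ≤ n := by exact_mod_cast hn
    rw [EReal.coe_lt_coe_iff]
    linarith
  · refine EReal.tendsto_nhds_top_iff_real.2 fun x => ?_
    obtain ⟨N, hN⟩ := exists_nat_gt x
    filter_upwards [eventually_ge_atTop N] with n hn
    have h1 : (n : ℝ) ≤ a n := by exact_mod_cast (h n).1 rfl
    have h2 : (N : ℝ) ≤ n := by exact_mod_cast hn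
    rw [EReal.coe_lt_coe_iff]
    linarith
  · simp only [fun n => (h n).2.2 m rfl, tendsto_const_nhds]

omit [NeZero k] in
lemma tendsto_of_agree {z : DeltaFreeWord k} {u : ℕ → DeltaFreeWord k}
    (h : ∀ n, Agree n (u n).1 z.1) : Tendsto u atTop (𝓝 z) := by
  have hn : 𝓝 z = ⨅ m : ℕ, comap (fun z : DeltaFreeWord k => z.1.get? m) (pure (z.1.get? m)) := by
    refine (nhds_iInf (t := fun m : ℕ =>
      TopologicalSpace.induced (fun z : DeltaFreeWord k => z.1.get? m) ⊥)).trans ?_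
    refine iInf_congr fun m => ?_
    exact (@nhds_induced _ _ ⊥ _ _).trans
      (congrArg _ (congrFun (@nhds_discrete (Option Bool) ⊥ (@DiscreteTopology.mk _ ⊥ rfl)) _))
  rw [hn, tendsto_iInf]
  refine fun m => tendsto_comap_iff.2 (tendsto_pure.2 ?_)
  filter_upwards [eventually_gt_atTop m] with n hn
  exact h n m hn

lemma mem_closure_range_point (hk : 2 ≤ k) (w : OmegaPrime k) :
    w.1 ∈ closure (Set.range (point (k := k))) := by
  choose g hg hc using exists_approx hk w
  refine mem_closure_of_tendsto (f := fun n => point (g n)) (b := atTop) ?_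
    (Eventually.of_forall fun n => Set.mem_range_self _)
  refine Tendsto.prodMk_nhds (tendsto_pi_nhds.2 fun i => tendsto_subtype_rng.2 ?_)
    (tendsto_of_agree hg)
  exact tendsto_of_approx (w.1.1 i).2 fun n => hc n i

/-! ### The homeomorphism -/

/-- Density of the group in Ω' gives one inclusion; the other holds because the image of a compact
space is closed and contains every φ_g. -/
lemma range_horoMap (hk : 2 ≤ k) :
    Set.range (fun w : OmegaPrime k => horoMap w.1) =
      horofunctionCompactification (1 : DihedralArtin k) := by
  have := compactSpace_omegaPrime hk
  apply subset_antisymm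
  · rintro _ ⟨w, rfl⟩
    refine map_mem_closure continuous_horoMap (mem_closure_range_point hk w) ?_
    rintro _ ⟨g, rfl⟩
    exact ⟨g, (horoMap_point hk g).symm⟩
  · refine closure_minimal ?_
      (isCompact_range (continuous_horoMap.comp continuous_subtype_val)).isClosed
    rintro _ ⟨g, rfl⟩
    exact ⟨⟨point g, point_mem hk g⟩, horoMap_point hk g⟩

lemma nonempty_homeomorph (hk : 2 ≤ k) :
    Nonempty (Omega k ≃ₜ horofunctionCompactification (1 : DihedralArtin k)) := by
  have := compactSpace_omegaPrime hk
  let f : Omega k → horofunctionCompactification (1 : DihedralArtin k) :=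
    Quot.lift (fun w => ⟨horoMap w.1, range_horoMap hk ▸ Set.mem_range_self w⟩)
      fun v w h => Subtype.ext (horoMap_eq_of_omegaRel h)
  have hf : Continuous f := continuous_quot_lift _
    ((continuous_horoMap.comp continuous_subtype_val).subtype_mk _)
  have hbij : Function.Bijective f := by
    constructor
    · rintro ⟨v⟩ ⟨w⟩ h
      rcases eq_or_omegaRel_of_horoMap_eq hk (congrArg Subtype.val h) with h | h
      · rw [h]
      · exact Quot.sound h
    · rintro ⟨φ, hφ⟩
      rw [← range_horoMap hk] at hφ
      obtain ⟨w, rfl⟩ := hφ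
      exact ⟨Quot.mk _ w, rfl⟩
  exact ⟨Continuous.homeoOfEquivCompactToT2 (f := Equiv.ofBijective f hbij) hf⟩

end DihedralArtin

theorem mainTheorem4 (k : ℕ) (hk : 3 ≤ k) :
    Nonempty (Omega k ≃ₜ horofunctionCompactification (1 : DihedralArtin k)) := by
  have : NeZero k := ⟨by omega⟩
  exact DihedralArtin.nonempty_homeomorph (by omega)
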